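/- Let $Q(w)=w(w-1)(w-z)$. There is a neighbourhood of $z=\frac12$ in $\mathbb{C}$ such that the following holds for every $z$ in it. Put $I_2(C,z)=\int_0^z Q(w)^C\,dw$ for $\operatorname{Re}C>-1$ (along the segment from $0$ to $z$), and let $I_1(C,z)$ be given by the convergent integral $\int_1^{\infty}Q(w)^C\,dw$ for $-1<\operatorname{Re}C<-\frac13$ and by its analytic continuation in $C$ to $\{\operatorname{Re}C>-1\}\setminus\{\frac{n-1}{3}: n=0,1,2,\dots\}$, which exists; the powers are principal. Let $w_+=\frac13(z+1)+\frac13(z^2-z+1)^{1/2}$ and $Q_+=Q(w_+)$ (so $Q_+=-\frac{\sqrt3}{36}$ at $z=\frac12$), and let $Q_+^C=e^{C\log Q_+}$ with $\log Q_+=\pi i+\log(-Q_+)$, the last logarithm being principal. Let $$\Phi(q)=q\,\frac{w_1+w_2-2w_0}{(w_0-w_1)(w_0-w_2)(w_1-w_2)},$$ where $w_0,w_1,w_2$ are the solutions of $w(w-1)(w-z)=q$, $$w_k=\frac{z+1}{3}+2\Big(-\frac u3\Big)^{1/2}\cos\Big(\frac13\arccos\Big(\frac{3v}{2u}\Big(-\frac3u\Big)^{1/2}\Big)+\alpha_k\Big),\qquad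 \alpha_0=\frac{2\pi}{3},\ \alpha_1=0,\ \alpha_2=-\frac{2\pi}{3},$$ with $u=\frac{3z-(z+1)^2}{3}$, $v=\frac{-2(z+1)^3+9z(z+1)-27q}{27}$ and principal branches, so that $w_0=0$, $w_1=1$, $w_2=z$ at $q=0$. Finally let $\mathfrak{L}^0 f=\int_0^{\infty}e^{-C\zeta}f(\zeta)\,d\zeta$. Then for every $C$ with $\operatorname{Re}C>-1$ the integrals $I_2(C,z)$ and $\mathfrak{L}^0\Phi(Q_+e^{-\zeta})$ converge absolutely, and if moreover $\sin(3\pi C)\neq0$, then $$I_1(C,z)=Q_+^{C}\,\frac{\sin(2\pi C)}{\sin(3\pi C)}\,e^{-\pi iC}\,\mathfrak{L}^0\Phi(Q_+e^{-\zeta})-\frac{\sin(\pi C)}{\sin(3\pi C)}\,I_2(C,z).$$ -/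

import Mathlib

noncomputable section

namespace CoulombGas

/-- The cubic polynomial `Q(w) = w (w - 1) (w - z)`. -/
def Q (z w : ℂ) : ℂ := w * (w - 1) * (w - z)

/-! ### The two conformal blocks -/

/-- The integral `∫₁^∞ Q(w)^C dw` along the real axis, with the principal branch of the power
(for real `z` in `(0, 1)` one has `Q > 0` on the path). -/
def I1Integral (C z : ℂ) : ℂ := ∫ w in Set.Ioi (1 : ℝ), Q z (w : ℂ) ^ C

/-- The half plane `Re C > -1` without the points `C = (n - 1) / 3`, `n = 0, 1, 2, …`, at which
the behaviour of `Q^C` at `w = ∞` can produce poles. It is open and connected, and it contains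
the strip `-1 < Re C < -1/3`. -/
def I1Domain : Set ℂ := {C | -1 < C.re ∧ ∀ n : ℕ, 3 * C + 1 ≠ (n : ℂ)}

/-- `F` is an analytic continuation, in the variable `C`, of the integral `∫₁^∞ Q^C dw` from its
strip of convergence `-1 < Re C < -1/3` to `I1Domain`. As that set is connected, two such functions
agree on it. -/
def IsI1Continuation (z : ℂ) (F : ℂ → ℂ) : Prop :=
  AnalyticOnNhd ℂ F I1Domain ∧
    ∀ C : ℂ, -1 < C.re → C.re < -1 / 3 → F C = I1Integral C z

open Classical in
/-- The conformal block `I₁(C, z)`: the integral `∫₁^∞ Q^C dw`, continued analytically in `C`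
(and just that integral, should there be no continuation). -/
def I1 (C z : ℂ) : ℂ :=
  if h : ∃ F : ℂ → ℂ, IsI1Continuation z F then h.choose C else I1Integral C z

/-- The conformal block `I₂(C, z) = ∫₀^z Q(w)^C dw` along the segment `w = t z`, `0 ≤ t ≤ 1`, with
the principal branch of the power (`Q > 0` on the path for real `z` in `(0, 1)`). -/
def I2 (C z : ℂ) : ℂ := ∫ t in (0 : ℝ)..1, Q z (t * z) ^ C * z

/-! ### Critical value and roots of the cubic -/

/-- The critical point `w₊(z) = (z + 1 + (z² - z + 1)^(1/2)) / 3` of `Q`. -/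
def wPlus (z : ℂ) : ℂ := (z + 1) / 3 + (z ^ 2 - z + 1) ^ (1 / 2 : ℂ) / 3

/-- The critical value `Q₊(z) = Q(w₊(z))`, which is `-√3/36` at `z = 1/2`. -/
def QPlus (z : ℂ) : ℂ := Q z (wPlus z)

/-- `Q₊(z)^C`, where `log Q₊` is the branch near `z = 1/2` with `log Q₊(1/2) = π i + log (√3/36)`.
Since `-Q₊` is near the positive number `√3/36`, this is `π i` plus the principal value of
`log (-Q₊)`. -/
def QPlusPow (C z : ℂ) : ℂ :=
  Complex.exp (C * (Real.pi * Complex.I + Complex.log (-QPlus z)))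

/-- The principal branch of `arccos`, holomorphic off `(-∞, -1] ∪ [1, ∞)`, with
`arccos 0 = π / 2`. -/
def arccos (x : ℂ) : ℂ :=
  -Complex.I * Complex.log (x + Complex.I * (1 - x ^ 2) ^ (1 / 2 : ℂ))

def u (z : ℂ) : ℂ := (3 * z - (z + 1) ^ 2) / 3

def v (q z : ℂ) : ℂ := (-2 * (z + 1) ^ 3 + 9 * z * (z + 1) - 27 * q) / 27

/-- The angle `(1/3) arccos ((3 v / (2 u)) (-3/u)^(1/2))`. -/
def angle (q z : ℂ) : ℂ :=
  arccos (3 * v q z / (2 * u z) * (-3 / u z) ^ (1 / 2 : ℂ)) / 3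

/-- The solution `w₀(q, z)` of `w (w - 1) (w - z) = q` with `w₀(0, z) = 0`. -/
def w0 (q z : ℂ) : ℂ :=
  (z + 1) / 3 + 2 * (-u z / 3) ^ (1 / 2 : ℂ) * Complex.cos (angle q z + 2 * Real.pi / 3)

/-- The solution `w₁(q, z)` of `w (w - 1) (w - z) = q` with `w₁(0, z) = 1`. -/
def w1 (q z : ℂ) : ℂ :=
  (z + 1) / 3 + 2 * (-u z / 3) ^ (1 / 2 : ℂ) * Complex.cos (angle q z)

/-- The solution `w₂(q, z)` of `w (w - 1) (w - z) = q` with `w₂(0, z) = z`. -/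
def w2 (q z : ℂ) : ℂ :=
  (z + 1) / 3 + 2 * (-u z / 3) ^ (1 / 2 : ℂ) * Complex.cos (angle q z - 2 * Real.pi / 3)

/-! ### The Borel germ and the Laplace transform -/

/-- `Φ(q) = q (w₁ + w₂ - 2 w₀) / ((w₀ - w₁) (w₀ - w₂) (w₁ - w₂))`, the `wᵢ` taken at `q`. -/
def Phi (q z : ℂ) : ℂ :=
  q * ((w1 q z + w2 q z - 2 * w0 q z) /
    ((w0 q z - w1 q z) * (w0 q z - w2 q z) * (w1 q z - w2 q z)))

/-- The Borel germ `φ(ζ) = Φ(Q₊ e^{-ζ})`. For `ζ > 0` the point `Q₊ e^{-ζ}` runs through the segment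
from `Q₊` to `0`, on which the argument of `arccos` in `wᵢ` stays off the cuts. -/
def phi (z ζ : ℂ) : ℂ := Phi (QPlus z * Complex.exp (-ζ)) z

/-- The integrand `e^{-C ζ} f(ζ) dζ` along the ray `ζ = e^{iθ} t`, `t > 0`. -/
def laplaceIntegrand (θ : ℝ) (f : ℂ → ℂ) (C : ℂ) (t : ℝ) : ℂ :=
  Complex.exp (-C * (Complex.exp (θ * Complex.I) * t)) * f (Complex.exp (θ * Complex.I) * t) *
    Complex.exp (θ * Complex.I)

/-- The Laplace transform `(𝔏^θ f)(C) = ∫₀^{e^{iθ}∞} e^{-C ζ} f(ζ) dζ` in the direction `θ`. -/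
def laplace (θ : ℝ) (f : ℂ → ℂ) (C : ℂ) : ℂ :=
  ∫ t in Set.Ioi (0 : ℝ), laplaceIntegrand θ f C t

end CoulombGas

end

/-! The proof inserts a third block `I3`, the integral of `(-Q)^C` over the segment from `z` to `1`,
and combines two identities for it.

The first is a linear relation, `sin(3πC) I₁ + sin(2πC) I₃ + sin(πC) I₂ = 0`. For real `z` in `(0,
1)` and `-1 < Re C < -1/3`, the product `w^C (w-1)^C (w-z)^C` is holomorphic in the upper half plane
and decays fast enough for its integral over the real axis to vanish. Its boundary values are
`|Q|^C` times `e^{πiC}` to the number of negative factors. This gives one equation between four real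
integrals. Conjugating the equation for `conj C` gives a second one with `e^{-πiC}`, and eliminating
the integral over `(-∞, 0)` leaves the sine relation (`sin_mul_integral_absCubicPow`). All terms are
holomorphic in `z`, so the relation extends to complex `z` by the identity theorem (`sin_relation`).
Since `I₂` and `I₃` are holomorphic for `Re C > -1`, solving for `I₁` also yields its continuation
in `C`.

The second is `Q₊^C e^{-πiC} 𝔏⁰Φ = -I₃` (`QPlusPow_mul_laplace`). For real `z`, `-Q` rises on `(z,
1)` from `0` to `-Q₊` at the critical point `w₊` and falls back to `0`. Substituting `Q(w) = Q₊
e^{-ζ}` on each monotone piece turns `∫ (-Q)^C dw` into Laplace integrals of `q / Q'(w₂)` and `q /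
Q'(w₁)`, and by partial fractions `Φ` is the difference of these two functions (`Phi_eq_sub`). Again
the identity theorem passes to complex `z`.

The cosine formulas for the roots are handled through `Q_chebyshev`: in a suitable affine coordinate
the cubic is, up to scale and an additive constant, `4x³ - 3x = cos 3θ` with `x = cos θ`. This
identifies the branches on `(z, 1)` and bounds the germ by a multiple of `τ / √(1 - τ)` with `τ =
e^{-ζ}`, so the Laplace integral converges for `Re C > -1` and is holomorphic in `z`. -/

open Complex MeasureTheory Set Filter Topology Metric ComplexConjugate

namespace CoulombGas

/-! ### Holomorphic dependence of integrals on parameters, and bounds for powers -/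

/-- A parametric integral of holomorphic functions that are locally dominated is holomorphic. -/
theorem differentiableAt_integral_of_dominated {α : Type*} [MeasurableSpace α] {μ : Measure α}
    {F : ℂ → α → ℂ} {z₀ : ℂ} {r : ℝ} (hr : 0 < r) {bound : α → ℝ}
    (hmeas : ∀ z ∈ ball z₀ r, AEStronglyMeasurable (F z) μ)
    (hdiff : ∀ᵐ a ∂μ, DifferentiableOn ℂ (F · a) (ball z₀ r))
    (hbound : ∀ᵐ a ∂μ, ∀ z ∈ ball z₀ r, ‖F z a‖ ≤ bound a)
    (hint : Integrable bound μ) :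
    DifferentiableAt ℂ (fun z => ∫ a, F z a ∂μ) z₀ := by
  have hz₀ : z₀ ∈ ball z₀ r := mem_ball_self hr
  have hd : ∀ᵐ a ∂μ, ∀ z ∈ ball z₀ r, HasDerivAt (F · a) (deriv (F · a) z) z := by
    filter_upwards [hdiff] with a ha z hz
    exact (ha.differentiableAt (isOpen_ball.mem_nhds hz)).hasDerivAt
  have hF'meas : AEStronglyMeasurable (fun a => deriv (F · a) z₀) μ := by
    -- The derivative is measurable in `a` as the limit of difference quotients along a sequence of
    -- positive reals decreasing to zero.
    obtain ⟨v, -, hv, hvt⟩ := exists_seq_strictAnti_tendsto' (show (0 : ℝ) < r from hr)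
    refine aestronglyMeasurable_of_tendsto_ae atTop
      (f := fun n a => ((v n : ℂ))⁻¹ • (F (z₀ + v n) a - F z₀ a)) ?_ ?_
    · intro n
      refine ((hmeas (z₀ + v n) ?_).sub (hmeas _ hz₀)).const_smul ((v n : ℂ))⁻¹
      have := hv n
      simp [abs_of_pos this.1, this.2]
    · filter_upwards [hd] with a ha
      have h := (ha z₀ hz₀).tendsto_slope_zero
      refine h.comp ?_
      refine tendsto_nhdsWithin_iff.2 ⟨?_, .of_forall fun n => ?_⟩
      · exact (Complex.continuous_ofReal.tendsto' 0 0 (by simp)).comp hvt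
      · simpa using (hv n).1.ne'
  have hsub : ball z₀ (r / 2) ∈ 𝓝 z₀ := ball_mem_nhds _ (half_pos hr)
  -- No bound on the derivative is assumed: for `z` within `r / 2` of the centre the disc of radius
  -- `r / 3` about `z` stays in the ball, and Cauchy's estimate there gives `bound a / (r / 3)`.
  refine (hasDerivAt_integral_of_dominated_loc_of_deriv_le (F' := fun z a => deriv (F · a) z)
    (bound := fun a => bound a / (r / 3)) hsub ?_ ?_ hF'meas ?_ (hint.div_const _) ?_).2.differentiableAt
  · exact eventually_of_mem (ball_mem_nhds _ hr) hmeas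
  · exact hint.mono' (hmeas _ hz₀) (hbound.mono fun a ha => ha _ hz₀)
  · filter_upwards [hdiff, hbound] with a ha hb z hz
    have hcl : closedBall z (r / 3) ⊆ ball z₀ r := by
      refine (closedBall_subset_ball' ?_)
      rw [mem_ball] at hz
      linarith
    refine Complex.norm_deriv_le_of_forall_mem_sphere_norm_le (by positivity) ?_ ?_
    · refine DifferentiableOn.diffContOnCl ?_
      rw [closure_ball _ (by positivity)]
      exact ha.mono hcl
    · intro w hw
      exact hb w (hcl (sphere_subset_closedBall hw))
  · filter_upwards [hd] with a ha z hz
    exact ha z (ball_subset_ball (by linarith) hz)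

theorem rpow_le_rpow_add_rpow {x a b c : ℝ} (hx : 0 < x) (hac : a ≤ c) (hcb : c ≤ b) :
    x ^ c ≤ x ^ a + x ^ b := by
  rcases le_total x 1 with h | h
  · exact (Real.rpow_le_rpow_of_exponent_ge hx h hac).trans
      (le_add_of_nonneg_right (Real.rpow_nonneg hx.le _))
  · exact (Real.rpow_le_rpow_of_exponent_le h hcb).trans
      (le_add_of_nonneg_left (Real.rpow_nonneg hx.le _))

theorem rpow_le_mul_rpow_of_comparable {m M a x : ℝ} (c : ℝ) (hm : 0 < m) (hM : 0 < M)
    (ha : 0 < a) (h1 : m * a ≤ x) (h2 : x ≤ M * a) : x ^ c ≤ (m ^ c + M ^ c) * a ^ c := by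
  have hx : 0 < x := (mul_pos hm ha).trans_le h1
  rw [add_mul, ← Real.mul_rpow hm.le ha.le, ← Real.mul_rpow hM.le ha.le]
  rcases le_total 0 c with h | h
  · exact (Real.rpow_le_rpow hx.le h2 h).trans
      (le_add_of_nonneg_left (Real.rpow_nonneg (by positivity) _))
  · exact (Real.rpow_le_rpow_of_nonpos (by positivity) h1 h).trans
      (le_add_of_nonneg_right (Real.rpow_nonneg (by positivity) _))

theorem norm_cpow_le_rpow_mul_exp {w : ℂ} (hw : w ≠ 0) (C : ℂ) :
    ‖w ^ C‖ ≤ ‖w‖ ^ C.re * Real.exp (Real.pi * |C.im|) := by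
  rw [Complex.norm_cpow_of_ne_zero hw, div_eq_mul_inv, ← Real.exp_neg]
  refine mul_le_mul_of_nonneg_left (Real.exp_le_exp.2 ?_) (Real.rpow_nonneg (norm_nonneg _) _)
  refine (neg_le_abs _).trans ?_
  rw [abs_mul]
  exact mul_le_mul_of_nonneg_right (Complex.abs_arg_le_pi w) (abs_nonneg _)

/-- Holomorphy in the exponent of the integral of a complex power. -/
theorem differentiableAt_integral_cpow {α : Type*} [MeasurableSpace α] {μ : Measure α}
    {g h : α → ℂ} (hg : AEMeasurable g μ) (hh : AEStronglyMeasurable h μ)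
    (hne : ∀ᵐ x ∂μ, g x ≠ 0) {a b : ℝ}
    (ha : Integrable (fun x => ‖g x‖ ^ a * ‖h x‖) μ)
    (hb : Integrable (fun x => ‖g x‖ ^ b * ‖h x‖) μ)
    {C : ℂ} (haC : a < C.re) (hCb : C.re < b) :
    DifferentiableAt ℂ (fun C => ∫ x, g x ^ C * h x ∂μ) C := by
  obtain ⟨r, hr, hr'⟩ : ∃ r > 0, ∀ D ∈ ball C r, a < D.re ∧ D.re < b := by
    have : {D : ℂ | a < D.re ∧ D.re < b} ∈ 𝓝 C :=
      ((isOpen_lt continuous_const Complex.continuous_re).inter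
        (isOpen_lt Complex.continuous_re continuous_const)).mem_nhds ⟨haC, hCb⟩
    exact Metric.mem_nhds_iff.1 this
  refine differentiableAt_integral_of_dominated (F := fun C x => g x ^ C * h x) hr
    (bound := fun x => (‖g x‖ ^ a * ‖h x‖ + ‖g x‖ ^ b * ‖h x‖) *
      Real.exp (Real.pi * (|C.im| + r))) ?_ ?_ ?_
    ((ha.add hb).mul_const _)
  · intro D hD
    exact (hg.pow_const D).aestronglyMeasurable.mul hh
  · filter_upwards [hne] with x hx
    exact fun D hD => ((differentiableAt_id.const_cpow (Or.inl hx)).mul_const _).differentiableWithinAt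
  · filter_upwards [hne] with x hx D hD
    have h1 := norm_cpow_le_rpow_mul_exp hx D
    have h2 := rpow_le_rpow_add_rpow (norm_pos_iff.2 hx) (hr' D hD).1.le (hr' D hD).2.le
    have h3 : |D.im| ≤ |C.im| + r := by
      have : |(D - C).im| ≤ ‖D - C‖ := Complex.abs_im_le_norm _
      have h4 : ‖D - C‖ < r := by simpa [dist_eq_norm] using hD
      have h5 := abs_sub_abs_le_abs_sub D.im C.im
      rw [Complex.sub_im] at this
      linarith
    rw [norm_mul]
    calc ‖g x ^ D‖ * ‖h x‖ ≤ ((‖g x‖ ^ a + ‖g x‖ ^ b) * Real.exp (Real.pi * (|C.im| + r))) * ‖h x‖ := by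
          gcongr
          refine h1.trans ?_
          gcongr
      _ = _ := by ring

/-! ### Integrability of the modulus of the cubic on the real line -/

/-- The model weight with the singularities of a cubic to a power `c ∈ (-1, -1/3)`. -/
theorem integrable_abs_rpow_mul_one_add_abs_rpow {c : ℝ} (h1 : -1 < c) (h2 : c < -1 / 3) :
    Integrable (fun y : ℝ => |y| ^ c * (1 + |y|) ^ (2 * c)) := by
  have hm : Measurable (fun y : ℝ => |y| ^ c * (1 + |y|) ^ (2 * c)) := by fun_prop
  have hpos : IntegrableOn (fun y : ℝ => |y| ^ c * (1 + |y|) ^ (2 * c)) (Ioi 0) := by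
    rw [← Ioc_union_Ioi_eq_Ioi (zero_le_one' ℝ)]
    refine IntegrableOn.union ?_ ?_
    · have : IntegrableOn (fun y : ℝ => y ^ c) (Ioc 0 1) :=
        (intervalIntegrable_iff_integrableOn_Ioc_of_le zero_le_one).1
          (intervalIntegral.intervalIntegrable_rpow' h1)
      refine Integrable.mono' this hm.aestronglyMeasurable ?_
      refine (ae_restrict_iff' measurableSet_Ioc).2 (.of_forall fun y hy => ?_)
      rw [Real.norm_of_nonneg (by positivity), abs_of_pos hy.1]
      refine mul_le_of_le_one_right (Real.rpow_nonneg hy.1.le _) ?_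
      exact Real.rpow_le_one_of_one_le_of_nonpos (by linarith [hy.1]) (by linarith)
    · have : IntegrableOn (fun y : ℝ => y ^ (3 * c)) (Ioi 1) :=
        integrableOn_Ioi_rpow_of_lt (by linarith) one_pos
      refine Integrable.mono' this hm.aestronglyMeasurable ?_
      refine (ae_restrict_iff' measurableSet_Ioi).2 (.of_forall fun y hy => ?_)
      have hy0 : 0 < y := one_pos.trans hy
      rw [Real.norm_of_nonneg (by positivity), abs_of_pos hy0,
        show 3 * c = c + 2 * c by ring, Real.rpow_add hy0]
      refine mul_le_mul_of_nonneg_left ?_ (Real.rpow_nonneg hy0.le _)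
      exact Real.rpow_le_rpow_of_nonpos hy0 (by linarith) (by linarith)
  have hneg : IntegrableOn (fun y : ℝ => |y| ^ c * (1 + |y|) ^ (2 * c)) (Iic 0) := by
    rw [integrableOn_Iic_iff_integrableOn_Iio]
    have := hpos.comp_neg
    simpa using this
  have := hneg.union hpos
  rwa [Iic_union_Ioi, integrableOn_univ] at this

/-- With `d` the distance to the nearest of three separated points, the other two distances are at
least `(δ / 4) (1 + d)`, so only one factor can be singular and the other two contribute only the
decay `(1 + d)^(2c)`. -/
theorem rpow_mul_rpow_mul_rpow_le_of_min {c δ d e f : ℝ} (hc : c ≤ 0) (hδ : 0 < δ) (hδ' : δ ≤ 1)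
    (hd : 0 ≤ d) (he : d ≤ e) (hf : d ≤ f) (hde : δ ≤ d + e) (hdf : δ ≤ d + f) :
    d ^ c * e ^ c * f ^ c ≤ ((δ / 4) ^ c) ^ 2 * (d ^ c * (1 + d) ^ (2 * c)) := by
  have key : ∀ g : ℝ, d ≤ g → δ ≤ d + g → g ^ c ≤ (δ / 4) ^ c * (1 + d) ^ c := by
    intro g hg hdg
    rw [← Real.mul_rpow (by positivity) (by positivity)]
    refine Real.rpow_le_rpow_of_nonpos (by positivity) ?_ hc
    nlinarith
  have h1 := key e he hde
  have h2 := key f hf hdf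
  have hd' := Real.rpow_nonneg hd c
  have h3 : (1 + d) ^ (2 * c) = (1 + d) ^ c * (1 + d) ^ c := by
    rw [two_mul, Real.rpow_add (by positivity)]
  rw [h3, mul_assoc]
  calc d ^ c * (e ^ c * f ^ c)
      ≤ d ^ c * (((δ / 4) ^ c * (1 + d) ^ c) * ((δ / 4) ^ c * (1 + d) ^ c)) := by
        have := Real.rpow_nonneg (hd.trans hf) c
        gcongr
    _ = _ := by ring

/-- The sum of the model weight centred at `0`, at `1` and at `z` dominates: at each `x` the summand
of the nearest point is already large enough. -/
theorem integrable_cubic_rpow {z c : ℝ} (hz0 : 0 < z) (hz1 : z < 1) (h1 : -1 < c)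
    (h2 : c < -1 / 3) :
    Integrable (fun x : ℝ => |x| ^ c * |x - 1| ^ c * |x - z| ^ c) := by
  have hk := integrable_abs_rpow_mul_one_add_abs_rpow h1 h2
  obtain ⟨δ, hδ, hδ1, hδz, hδz'⟩ : ∃ δ : ℝ, 0 < δ ∧ δ ≤ 1 ∧ δ ≤ z ∧ δ ≤ 1 - z :=
    ⟨min z (1 - z), lt_min hz0 (by linarith), (min_le_left _ _).trans hz1.le, min_le_left _ _,
      min_le_right _ _⟩
  refine Integrable.mono' (((hk.add (hk.comp_sub_right 1)).add (hk.comp_sub_right z)).const_mul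
    (((δ / 4) ^ c) ^ 2)) (by fun_prop) (.of_forall fun x => ?_)
  rw [Real.norm_of_nonneg (by positivity)]
  have hc : c ≤ 0 := by linarith
  have h01 : 1 ≤ |x| + |x - 1| := by
    have := abs_sub x (x - 1)
    simpa using this
  have h0z : z ≤ |x| + |x - z| := by
    have := abs_sub x (x - z)
    rw [sub_sub_cancel, abs_of_pos hz0] at this
    exact this
  have h1z : 1 - z ≤ |x - 1| + |x - z| := by
    have := abs_sub (x - z) (x - 1)
    rw [show x - z - (x - 1) = 1 - z by ring, abs_of_pos (by linarith)] at this
    linarith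
  have p0 : 0 ≤ |x| ^ c * (1 + |x|) ^ (2 * c) := by positivity
  have p1 : 0 ≤ |x - 1| ^ c * (1 + |x - 1|) ^ (2 * c) := by positivity
  have pz : 0 ≤ |x - z| ^ c * (1 + |x - z|) ^ (2 * c) := by positivity
  have pk : 0 ≤ ((δ / 4) ^ c) ^ 2 := by positivity
  simp only [Pi.add_apply]
  -- The cases decide which singular point is nearest; its factor is then moved to the front.
  rcases le_total |x| |x - 1| with ha | ha <;> rcases le_total |x| |x - z| with hb | hb <;>
    rcases le_total |x - 1| |x - z| with hd | hd
  all_goals first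
  | exact (rpow_mul_rpow_mul_rpow_le_of_min hc hδ hδ1 (abs_nonneg x) (by linarith) (by linarith)
      (by linarith) (by linarith)).trans (mul_le_mul_of_nonneg_left (by linarith) pk)
  | (rw [mul_comm (|x| ^ c)]
     exact (rpow_mul_rpow_mul_rpow_le_of_min hc hδ hδ1 (abs_nonneg (x - 1)) (by linarith)
      (by linarith) (by linarith) (by linarith)).trans
        (mul_le_mul_of_nonneg_left (by linarith) pk))
  | (rw [mul_comm _ (|x - z| ^ c), ← mul_assoc]
     exact (rpow_mul_rpow_mul_rpow_le_of_min hc hδ hδ1 (abs_nonneg (x - z)) (by linarith)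
      (by linarith) (by linarith) (by linarith)).trans
        (mul_le_mul_of_nonneg_left (by linarith) pk))

/-! ### The contour integral over the real axis and the sine relation for real `z` -/

/-- The product of the principal powers of the factors of a cubic. -/
noncomputable def factorPow (C : ℂ) (z : ℝ) (w : ℂ) : ℂ := w ^ C * (w - 1) ^ C * (w - z) ^ C

theorem mem_slitPlane_of_im_pos {w : ℂ} (h : 0 < w.im) : w ∈ slitPlane := Or.inr h.ne'

theorem differentiableAt_factorPow (C : ℂ) (z : ℝ) {w : ℂ} (h : 0 < w.im) :
    DifferentiableAt ℂ (factorPow C z) w := by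
  unfold factorPow
  refine ((differentiableAt_id.cpow_const (mem_slitPlane_of_im_pos h)).mul
    ((differentiableAt_id.sub_const _).cpow_const (mem_slitPlane_of_im_pos ?_))).mul
    ((differentiableAt_id.sub_const _).cpow_const (mem_slitPlane_of_im_pos ?_)) <;> simpa using h

theorem norm_cpow_le_of_re_neg {C w : ℂ} {d : ℝ} (hc : C.re ≤ 0) (hd : 0 < d) (h : d ≤ ‖w‖) :
    ‖w ^ C‖ ≤ d ^ C.re * Real.exp (Real.pi * |C.im|) :=
  (norm_cpow_le_rpow_mul_exp (norm_pos_iff.1 (hd.trans_le h)) C).trans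
    (mul_le_mul_of_nonneg_right (Real.rpow_le_rpow_of_nonpos hd h hc) (Real.exp_pos _).le)

theorem norm_factorPow_le {C : ℂ} {z : ℝ} {w : ℂ} {d₀ d₁ d₂ : ℝ} (hc : C.re ≤ 0) (h₀ : 0 < d₀)
    (h₁ : 0 < d₁) (h₂ : 0 < d₂) (hw₀ : d₀ ≤ ‖w‖) (hw₁ : d₁ ≤ ‖w - 1‖) (hw₂ : d₂ ≤ ‖w - z‖) :
    ‖factorPow C z w‖ ≤
      Real.exp (Real.pi * |C.im|) ^ 3 * (d₀ ^ C.re * d₁ ^ C.re * d₂ ^ C.re) := by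
  rw [factorPow, norm_mul, norm_mul]
  calc _ ≤ (d₀ ^ C.re * Real.exp (Real.pi * |C.im|)) * (d₁ ^ C.re * Real.exp (Real.pi * |C.im|)) *
        (d₂ ^ C.re * Real.exp (Real.pi * |C.im|)) := by
        gcongr
        · exact norm_cpow_le_of_re_neg hc h₀ hw₀
        · exact norm_cpow_le_of_re_neg hc h₁ hw₁
        · exact norm_cpow_le_of_re_neg hc h₂ hw₂
    _ = _ := by ring

/-- Moving vertically only increases the distance to a real point, and the exponent has nonpositive
real part, so one function of `x` dominates at every height. This serves the horizontal limits as
well as the vertical sides of the contour. -/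
theorem norm_factorPow_add_mul_I_le {C : ℂ} {z x : ℝ} (hc : C.re ≤ 0) (h0 : x ≠ 0) (h1 : x ≠ 1)
    (hz : x ≠ z) (y : ℝ) :
    ‖factorPow C z (x + y * I)‖ ≤
      Real.exp (Real.pi * |C.im|) ^ 3 * (|x| ^ C.re * |x - 1| ^ C.re * |x - z| ^ C.re) := by
  have key : ∀ a : ℝ, |x - a| ≤ ‖(x : ℂ) + y * I - a‖ := by
    intro a
    refine le_trans (le_of_eq ?_) (Complex.abs_re_le_norm _)
    simp
  refine norm_factorPow_le hc (abs_pos.2 h0) (abs_pos.2 (sub_ne_zero.2 h1))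
    (abs_pos.2 (sub_ne_zero.2 hz)) ?_ ?_ (key z)
  · simpa using key 0
  · simpa using key 1

theorem ae_ne (a : ℝ) : ∀ᵐ x : ℝ, x ≠ a := by
  simp [ae_iff, measure_singleton]

theorem measurable_factorPow (C : ℂ) (z y : ℝ) :
    Measurable (fun x : ℝ => factorPow C z (x + y * I)) := by
  unfold factorPow
  fun_prop

theorem integrable_factorPow {C : ℂ} {z : ℝ} (hz0 : 0 < z) (hz1 : z < 1) (h1 : -1 < C.re)
    (h2 : C.re < -1 / 3) (y : ℝ) : Integrable (fun x : ℝ => factorPow C z (x + y * I)) := by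
  refine Integrable.mono' ((integrable_cubic_rpow hz0 hz1 h1 h2).const_mul
    (Real.exp (Real.pi * |C.im|) ^ 3)) (measurable_factorPow C z y).aestronglyMeasurable ?_
  filter_upwards [ae_ne 0, ae_ne 1, ae_ne z] with x hx0 hx1 hxz
  exact norm_factorPow_add_mul_I_le (by linarith) hx0 hx1 hxz y

theorem tendsto_abs_sub_rpow_cocompact {c : ℝ} (hc : c < 0) (a : ℝ) :
    Tendsto (fun x : ℝ => |x - a| ^ c) (cocompact ℝ) (𝓝 0) := by
  have h := tendsto_rpow_neg_atTop (neg_pos.2 hc)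
  rw [neg_neg] at h
  refine h.comp ?_
  have : Tendsto (fun x : ℝ => x - a) (cocompact ℝ) (cocompact ℝ) :=
    (Homeomorph.subRight a).isClosedEmbedding.tendsto_cocompact
  exact (tendsto_norm_cocompact_atTop (E := ℝ)).comp this

theorem tendsto_verticalIntegral_factorPow {C : ℂ} (z : ℝ) (hc : C.re < 0) (y₁ y₂ : ℝ) :
    Tendsto (fun x : ℝ => ∫ y in y₁..y₂, factorPow C z (x + y * I)) (cocompact ℝ) (𝓝 0) := by
  have h := ((((tendsto_abs_sub_rpow_cocompact hc 0).mul
    (tendsto_abs_sub_rpow_cocompact hc 1)).mul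
    (tendsto_abs_sub_rpow_cocompact hc z)).const_mul (Real.exp (Real.pi * |C.im|) ^ 3)).mul_const
    |y₂ - y₁|
  simp only [sub_zero, mul_zero, zero_mul] at h
  refine squeeze_zero_norm' ?_ h
  have hne : ∀ a : ℝ, ∀ᶠ x in cocompact ℝ, x ≠ a := fun a =>
    (isCompact_singleton (x := a)).compl_mem_cocompact
  filter_upwards [hne 0, hne 1, hne z] with x h0 h1 hz
  exact intervalIntegral.norm_integral_le_of_norm_le_const fun y _ =>
    norm_factorPow_add_mul_I_le hc.le h0 h1 hz y

/-- The integral of the product of powers over a horizontal line does not depend on its height. -/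
theorem integral_factorPow_eq {C : ℂ} {z : ℝ} (hz0 : 0 < z) (hz1 : z < 1) (h1 : -1 < C.re)
    (h2 : C.re < -1 / 3) {y₁ y₂ : ℝ} (hy₁ : 0 < y₁) (hy₂ : 0 < y₂) :
    ∫ x : ℝ, factorPow C z (x + y₁ * I) = ∫ x : ℝ, factorPow C z (x + y₂ * I) := by
  have hc : C.re < 0 := by linarith
  have hh : ∀ y : ℝ, Tendsto (fun R : ℝ => ∫ x in (-R)..R, factorPow C z (x + y * I)) atTop
      (𝓝 (∫ x : ℝ, factorPow C z (x + y * I))) := fun y =>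
    intervalIntegral_tendsto_integral (integrable_factorPow hz0 hz1 h1 h2 y)
      tendsto_neg_atTop_atBot tendsto_id
  have hv := tendsto_verticalIntegral_factorPow z hc y₁ y₂
  have hv1 := hv.comp (atTop_le_cocompact (α := ℝ))
  have hv2 := hv.comp ((atBot_le_cocompact (α := ℝ)).trans' tendsto_neg_atTop_atBot)
  -- The four sides of the rectangle between heights `y₁` and `y₂`; as `R → ∞` the vertical ones
  -- vanish.
  have hlim := (((hh y₁).sub (hh y₂)).add (hv1.const_smul I)).sub (hv2.const_smul I)
  have hzero : ∀ R : ℝ, (∫ x in (-R)..R, factorPow C z (x + y₁ * I)) -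
      (∫ x in (-R)..R, factorPow C z (x + y₂ * I)) +
      I • (∫ y in y₁..y₂, factorPow C z (R + y * I)) -
      I • (∫ y in y₁..y₂, factorPow C z ((-R : ℝ) + y * I)) = 0 := by
    intro R
    have := Complex.integral_boundary_rect_eq_zero_of_differentiableOn (factorPow C z)
      (⟨-R, y₁⟩ : ℂ) (⟨R, y₂⟩ : ℂ) ?_
    · simpa using this
    · intro w hw
      refine (differentiableAt_factorPow C z ?_).differentiableWithinAt
      have := hw.2.1
      exact (lt_min hy₁ hy₂).trans_le this
  have := tendsto_nhds_unique hlim (tendsto_const_nhds.congr fun R => (hzero R).symm)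
  simpa [sub_eq_zero] using this

/-- On the negative axis the principal logarithm has argument `π`, which is its limit from above.
Hence boundary values from the upper half plane are the principal powers themselves. -/
theorem tendsto_ofReal_add_mul_I_cpow {x : ℝ} (hx : x ≠ 0) (C : ℂ) :
    Tendsto (fun y : ℝ => ((x : ℂ) + y * I) ^ C) (𝓝[>] 0) (𝓝 ((x : ℂ) ^ C)) := by
  have hx' : (x : ℂ) ≠ 0 := ofReal_ne_zero.2 hx
  have hpath : Tendsto (fun y : ℝ => (x : ℂ) + y * I) (𝓝[>] 0) (𝓝[{w | 0 ≤ w.im}] (x : ℂ)) := by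
    refine tendsto_nhdsWithin_iff.2 ⟨?_, ?_⟩
    · have : Continuous (fun y : ℝ => (x : ℂ) + y * I) := by fun_prop
      exact (this.tendsto' 0 _ (by simp)).mono_left nhdsWithin_le_nhds
    · filter_upwards [self_mem_nhdsWithin] with y hy
      simpa using le_of_lt hy
  have hlog : Tendsto Complex.log (𝓝[{w | 0 ≤ w.im}] (x : ℂ)) (𝓝 (Complex.log x)) := by
    rcases lt_or_gt_of_ne hx with h | h
    · exact (Complex.continuousWithinAt_log_of_re_neg_of_im_zero (by simpa) (by simp))
    · exact ((continuousAt_clog (Or.inl (by simpa))).mono_left nhdsWithin_le_nhds)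
  rw [cpow_def_of_ne_zero hx']
  refine Tendsto.congr' ?_ ((continuous_exp.tendsto _).comp ((hlog.comp hpath).mul_const C))
  filter_upwards [self_mem_nhdsWithin] with y hy
  rw [cpow_def_of_ne_zero]
  · rfl
  · intro h
    have := congrArg Complex.im h
    simp at this
    exact (ne_of_gt hy) this

theorem tendsto_factorPow {C : ℂ} {z x : ℝ} (h0 : x ≠ 0) (h1 : x ≠ 1) (hz : x ≠ z) :
    Tendsto (fun y : ℝ => factorPow C z (x + y * I)) (𝓝[>] 0) (𝓝 (factorPow C z x)) := by
  have a0 := tendsto_ofReal_add_mul_I_cpow h0 C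
  have a1 := tendsto_ofReal_add_mul_I_cpow (sub_ne_zero.2 h1) C
  have az := tendsto_ofReal_add_mul_I_cpow (sub_ne_zero.2 hz) C
  have := (a0.mul a1).mul az
  unfold factorPow
  refine (this.congr fun y => ?_).trans (le_of_eq ?_)
  · push_cast
    ring_nf
  · push_cast; rfl

/-- Closing the contour in the upper half plane. -/
theorem integral_factorPow_eq_zero {C : ℂ} {z : ℝ} (hz0 : 0 < z) (hz1 : z < 1) (h1 : -1 < C.re)
    (h2 : C.re < -1 / 3) : ∫ x : ℝ, factorPow C z x = 0 := by
  have hc : C.re < 0 := by linarith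
  have hint := (integrable_cubic_rpow hz0 hz1 h1 h2).const_mul (Real.exp (Real.pi * |C.im|) ^ 3)
  have hbd : ∀ y : ℝ, ∀ᵐ x : ℝ, ‖factorPow C z (x + y * I)‖ ≤
      Real.exp (Real.pi * |C.im|) ^ 3 * (|x| ^ C.re * |x - 1| ^ C.re * |x - z| ^ C.re) := by
    intro y
    filter_upwards [ae_ne 0, ae_ne 1, ae_ne z] with x hx0 hx1 hxz
    exact norm_factorPow_add_mul_I_le hc.le hx0 hx1 hxz y
  have hlow : Tendsto (fun y : ℝ => ∫ x : ℝ, factorPow C z (x + y * I)) (𝓝[>] 0)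
      (𝓝 (∫ x : ℝ, factorPow C z x)) := by
    refine tendsto_integral_filter_of_dominated_convergence _
      (.of_forall fun y => (measurable_factorPow C z y).aestronglyMeasurable)
      (.of_forall hbd) hint ?_
    filter_upwards [ae_ne 0, ae_ne 1, ae_ne z] with x hx0 hx1 hxz
    exact tendsto_factorPow hx0 hx1 hxz
  -- At height `y` every factor has modulus at least `y`, so the integrand tends to zero pointwise;
  -- the dominating function is the one used for height tending to zero.
  have hhigh : Tendsto (fun y : ℝ => ∫ x : ℝ, factorPow C z (x + y * I)) atTop
      (𝓝 (∫ _ : ℝ, (0 : ℂ))) := by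
    refine tendsto_integral_filter_of_dominated_convergence _
      (.of_forall fun y => (measurable_factorPow C z y).aestronglyMeasurable)
      (.of_forall hbd) hint (.of_forall fun x => ?_)
    have hy : Tendsto (fun y : ℝ => y ^ C.re) atTop (𝓝 0) := by
      simpa using tendsto_rpow_neg_atTop (neg_pos.2 hc)
    have h := ((hy.mul hy).mul hy).const_mul (Real.exp (Real.pi * |C.im|) ^ 3)
    simp only [mul_zero] at h
    refine squeeze_zero_norm' ?_ h
    filter_upwards [eventually_gt_atTop 0] with y hy
    have key : ∀ a : ℝ, y ≤ ‖(x : ℂ) + y * I - a‖ := by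
      intro a
      refine le_trans (le_of_eq ?_) (Complex.abs_im_le_norm _)
      simp [abs_of_pos hy]
    exact norm_factorPow_le hc.le hy hy hy (by simpa using key 0) (by simpa using key 1) (key z)
  rw [integral_zero] at hhigh
  have hconst : ∀ y : ℝ, 0 < y →
      ∫ x : ℝ, factorPow C z (x + (1 : ℝ) * I) = ∫ x : ℝ, factorPow C z (x + y * I) := fun y hy =>
    integral_factorPow_eq hz0 hz1 h1 h2 one_pos hy
  have e1 := tendsto_nhds_unique hlow (tendsto_const_nhds.congr'
    (eventually_mem_nhdsWithin.mono fun y hy => hconst y hy))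
  have e2 := tendsto_nhds_unique hhigh (tendsto_const_nhds.congr'
    ((eventually_gt_atTop 0).mono hconst))
  rw [e1, e2]

/-- The power of the modulus of the cubic on the real axis. -/
noncomputable def absCubicPow (C : ℂ) (z x : ℝ) : ℂ := ((|x| * |x - 1| * |x - z| : ℝ) : ℂ) ^ C

theorem absCubicPow_eq_mul (C : ℂ) (z x : ℝ) :
    absCubicPow C z x = ((|x| : ℝ) : ℂ) ^ C * ((|x - 1| : ℝ) : ℂ) ^ C * ((|x - z| : ℝ) : ℂ) ^ C := by
  rw [absCubicPow, ofReal_mul, mul_cpow_ofReal_nonneg (by positivity) (by positivity), ofReal_mul,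
    mul_cpow_ofReal_nonneg (by positivity) (by positivity)]

theorem ofReal_cpow_of_neg {x : ℝ} (hx : x < 0) (C : ℂ) :
    (x : ℂ) ^ C = ((|x| : ℝ) : ℂ) ^ C * exp (Real.pi * I * C) := by
  rw [ofReal_cpow_of_nonpos hx.le, abs_of_neg hx, ofReal_neg]

theorem factorPow_of_lt_zero {C : ℂ} {z x : ℝ} (hz0 : 0 < z) (hx : x < 0) :
    factorPow C z x = exp (Real.pi * I * C) ^ 3 * absCubicPow C z x := by
  have h := ofReal_cpow_of_neg hx C
  have h1 := ofReal_cpow_of_neg (show x - 1 < 0 by linarith) C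
  have h2 := ofReal_cpow_of_neg (show x - z < 0 by linarith) C
  rw [absCubicPow_eq_mul, factorPow, ← ofReal_one, ← ofReal_sub, ← ofReal_sub, h, h1, h2]
  ring

theorem factorPow_of_mem_Ioo_zero {C : ℂ} {z x : ℝ} (hz1 : z < 1) (hx : x ∈ Ioo 0 z) :
    factorPow C z x = exp (Real.pi * I * C) ^ 2 * absCubicPow C z x := by
  have h1 := ofReal_cpow_of_neg (show x - 1 < 0 by linarith [hx.2]) C
  have h2 := ofReal_cpow_of_neg (show x - z < 0 by linarith [hx.2]) C
  rw [absCubicPow_eq_mul, factorPow, ← ofReal_one, ← ofReal_sub, ← ofReal_sub, h1, h2,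
    abs_of_pos hx.1]
  ring

theorem factorPow_of_mem_Ioo_one {C : ℂ} {z x : ℝ} (hz0 : 0 < z) (hx : x ∈ Ioo z 1) :
    factorPow C z x = exp (Real.pi * I * C) * absCubicPow C z x := by
  have h1 := ofReal_cpow_of_neg (show x - 1 < 0 by linarith [hx.2]) C
  rw [absCubicPow_eq_mul, factorPow, ← ofReal_one, ← ofReal_sub, ← ofReal_sub, h1,
    abs_of_pos (hz0.trans hx.1), abs_of_pos (sub_pos.2 hx.1)]
  ring

theorem factorPow_of_one_lt {C : ℂ} {z x : ℝ} (hz1 : z < 1) (hx : 1 < x) :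
    factorPow C z x = absCubicPow C z x := by
  rw [absCubicPow_eq_mul, factorPow, abs_of_pos (by linarith), abs_of_pos (by linarith),
    abs_of_pos (by linarith)]
  push_cast
  rfl

/-- The base is a nonnegative real, so conjugating the value of the power amounts to conjugating the
exponent. -/
theorem integral_absCubicPow_conj (C : ℂ) (z : ℝ) (S : Set ℝ) :
    ∫ x in S, absCubicPow (conj C) z x = conj (∫ x in S, absCubicPow C z x) := by
  rw [← integral_conj]
  congr 1 with x
  rw [absCubicPow, cpow_conj, conj_ofReal]
  · rfl
  · rw [arg_ofReal_of_nonneg (by positivity)]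
    exact Real.pi_pos.ne

/-- Each negative factor among `x`, `x - 1`, `x - z` contributes a phase `e^{πiC}`, and there are
three, two, one and none of them on the successive intervals. -/
theorem sum_integral_absCubicPow_eq_zero {C : ℂ} {z : ℝ} (hz0 : 0 < z) (hz1 : z < 1)
    (h1 : -1 < C.re) (h2 : C.re < -1 / 3) :
    exp (Real.pi * I * C) ^ 3 * (∫ x in Iio 0, absCubicPow C z x) +
      exp (Real.pi * I * C) ^ 2 * (∫ x in Ioo 0 z, absCubicPow C z x) +
      exp (Real.pi * I * C) * (∫ x in Ioo z 1, absCubicPow C z x) +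
      ∫ x in Ioi 1, absCubicPow C z x = 0 := by
  have hf : Integrable (fun x : ℝ => factorPow C z x) := by
    simpa using integrable_factorPow hz0 hz1 h1 h2 0
  have e0 := integral_factorPow_eq_zero hz0 hz1 h1 h2
  rw [← intervalIntegral.integral_Iic_add_Ioi (b := 1) hf.integrableOn hf.integrableOn,
    ← Iic_union_Ioc_eq_Iic hz1.le, setIntegral_union (Iic_disjoint_Ioc le_rfl) measurableSet_Ioc
      hf.integrableOn hf.integrableOn, ← Iic_union_Ioc_eq_Iic hz0.le,
    setIntegral_union (Iic_disjoint_Ioc le_rfl) measurableSet_Ioc hf.integrableOn hf.integrableOn,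
    integral_Iic_eq_integral_Iio, integral_Ioc_eq_integral_Ioo, integral_Ioc_eq_integral_Ioo,
    setIntegral_congr_fun measurableSet_Iio fun x hx => factorPow_of_lt_zero hz0 hx,
    setIntegral_congr_fun measurableSet_Ioo fun x hx => factorPow_of_mem_Ioo_zero hz1 hx,
    setIntegral_congr_fun measurableSet_Ioo fun x hx => factorPow_of_mem_Ioo_one hz0 hx,
    setIntegral_congr_fun measurableSet_Ioi fun x hx => factorPow_of_one_lt hz1 hx] at e0
  simpa only [integral_const_mul] using e0

theorem sin_nat_mul_pi_mul (C : ℂ) (n : ℕ) :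
    Complex.sin (n * (Real.pi * C)) =
      ((exp (Real.pi * I * C))⁻¹ ^ n - exp (Real.pi * I * C) ^ n) * I / 2 := by
  rw [Complex.sin, ← Complex.exp_neg, ← Complex.exp_nat_mul, ← Complex.exp_nat_mul]
  congr 3
  · congr 1
    ring_nf
  · congr 1
    ring_nf

/-- The relation between the three conformal blocks on the real axis. -/
theorem sin_mul_integral_absCubicPow {C : ℂ} {z : ℝ} (hz0 : 0 < z) (hz1 : z < 1)
    (h1 : -1 < C.re) (h2 : C.re < -1 / 3) :
    Complex.sin (3 * Real.pi * C) * (∫ x in Ioi 1, absCubicPow C z x) +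
      Complex.sin (2 * Real.pi * C) * (∫ x in Ioo z 1, absCubicPow C z x) +
      Complex.sin (Real.pi * C) * (∫ x in Ioo 0 z, absCubicPow C z x) = 0 := by
  have e1 := sum_integral_absCubicPow_eq_zero hz0 hz1 h1 h2
  -- This is the relation that closing the contour in the lower half plane would give, with
  -- `e^{-πiC}` in place of `e^{πiC}`.
  have e2 := congrArg conj (sum_integral_absCubicPow_eq_zero (C := conj C) hz0 hz1 (by simpa)
    (by simpa))
  have hexp : conj (exp (Real.pi * I * conj C)) = (exp (Real.pi * I * C))⁻¹ := by
    rw [← Complex.exp_conj, ← Complex.exp_neg]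
    simp
  simp only [integral_absCubicPow_conj, map_add, map_mul, map_pow, hexp, Complex.conj_conj,
    map_zero] at e2
  have s1 := sin_nat_mul_pi_mul C 1
  have s2 := sin_nat_mul_pi_mul C 2
  have s3 := sin_nat_mul_pi_mul C 3
  rw [show ((1 : ℕ) : ℂ) * (Real.pi * C) = Real.pi * C by push_cast; ring] at s1
  rw [show ((2 : ℕ) : ℂ) * (Real.pi * C) = 2 * Real.pi * C by push_cast; ring] at s2
  rw [show ((3 : ℕ) : ℂ) * (Real.pi * C) = 3 * Real.pi * C by push_cast; ring] at s3
  have hne := Complex.exp_ne_zero (Real.pi * I * C)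
  have hi := mul_inv_cancel₀ hne
  rw [s1, s2, s3]
  generalize exp (Real.pi * I * C) = e at *
  generalize e⁻¹ = f at *
  generalize (∫ x in Ioi 1, absCubicPow C z x) = J1 at *
  generalize (∫ x in Ioo z 1, absCubicPow C z x) = J3 at *
  generalize (∫ x in Ioo 0 z, absCubicPow C z x) = J2 at *
  generalize (∫ x in Iio 0, absCubicPow C z x) = J0 at *
  have hef2 : e ^ 2 * f ^ 2 = 1 := by rw [← mul_pow, hi, one_pow]
  have hef3 : e ^ 3 * f ^ 3 = 1 := by rw [← mul_pow, hi, one_pow]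
  have hfe3 : f ^ 3 * e ^ 2 = f := by
    calc f ^ 3 * e ^ 2 = f * (e ^ 2 * f ^ 2) := by ring
      _ = f := by rw [hef2, mul_one]
  have hfe3' : f ^ 3 * e = f ^ 2 := by
    calc f ^ 3 * e = f ^ 2 * (e * f) := by ring
      _ = f ^ 2 := by rw [hi, mul_one]
  have hef3' : e ^ 3 * f ^ 2 = e := by
    calc e ^ 3 * f ^ 2 = e * (e ^ 2 * f ^ 2) := by ring
      _ = e := by rw [hef2, mul_one]
  have hef3'' : e ^ 3 * f = e ^ 2 := by
    calc e ^ 3 * f = e ^ 2 * (e * f) := by ring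
      _ = e ^ 2 := by rw [hi, mul_one]
  -- Multiplying the two relations by `e^{-3πiC}` and `e^{3πiC}` gives `J0` coefficient one in both;
  -- their difference has the coefficients `f - e`, `f² - e²`, `f³ - e³`, which are the three sines
  -- up to a common factor.
  linear_combination (I / 2) * f ^ 3 * e1 - (I / 2) * e ^ 3 * e2 - (I / 2) * J2 * hfe3 -
    (I / 2) * J3 * hfe3' + (I / 2) * J2 * hef3' + (I / 2) * J3 * hef3''

/-! ### The three blocks at real `z` -/

/-- The block between `z` and `1`, on which `-Q` is positive for real `z` in `(0, 1)`. -/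
noncomputable def I3 (C z : ℂ) : ℂ := ∫ t in (0 : ℝ)..1, (-Q z (z + t * (1 - z))) ^ C * (1 - z)

theorem I1Integral_ofReal (C : ℂ) {z : ℝ} (hz1 : z < 1) :
    I1Integral C z = ∫ x in Ioi 1, absCubicPow C z x := by
  refine setIntegral_congr_fun measurableSet_Ioi fun x hx => ?_
  have hx' : 1 < x := hx
  simp only [absCubicPow, Q]
  rw [abs_of_pos (by linarith), abs_of_pos (by linarith), abs_of_pos (by linarith)]
  push_cast
  rfl

theorem I2_ofReal (C : ℂ) {z : ℝ} (hz0 : 0 < z) (hz1 : z < 1) :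
    I2 C z = ∫ x in Ioo 0 z, absCubicPow C z x := by
  have h : I2 C z = ∫ t in (0 : ℝ)..1, absCubicPow C z (t * z) * z := by
    refine intervalIntegral.integral_congr fun t ht => ?_
    rw [uIcc_of_le zero_le_one] at ht
    simp only [absCubicPow, Q]
    rw [abs_of_nonneg (mul_nonneg ht.1 hz0.le), abs_of_nonpos (by nlinarith [ht.1, ht.2]),
      abs_of_nonpos (by nlinarith [ht.1, ht.2])]
    push_cast
    ring_nf
  rw [h, intervalIntegral.integral_mul_const, intervalIntegral.integral_comp_mul_right _ hz0.ne',
    ← integral_Ioc_eq_integral_Ioo, ← intervalIntegral.integral_of_le hz0.le, zero_mul, one_mul,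
    real_smul, ofReal_inv]
  have : (z : ℂ) ≠ 0 := ofReal_ne_zero.2 hz0.ne'
  field_simp

theorem I3_ofReal (C : ℂ) {z : ℝ} (hz0 : 0 < z) (hz1 : z < 1) :
    I3 C z = ∫ x in Ioo z 1, absCubicPow C z x := by
  have h : I3 C z = ∫ t in (0 : ℝ)..1, absCubicPow C z (z + (1 - z) * t) * ((1 - z : ℝ) : ℂ) := by
    refine intervalIntegral.integral_congr fun t ht => ?_
    rw [uIcc_of_le zero_le_one] at ht
    have h0 : 0 ≤ (1 - z) * t := mul_nonneg (by linarith) ht.1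
    simp only [absCubicPow, Q]
    rw [abs_of_nonneg (by linarith), abs_of_nonpos (by nlinarith [ht.1, ht.2]),
      abs_of_nonneg (by linarith)]
    push_cast
    ring_nf
  have hz : (1 - z) ≠ 0 := by linarith
  rw [h, intervalIntegral.integral_mul_const, intervalIntegral.integral_comp_add_mul _ hz,
    ← integral_Ioc_eq_integral_Ioo, ← intervalIntegral.integral_of_le hz1.le, mul_zero, mul_one,
    add_zero, add_sub_cancel, real_smul, ofReal_inv]
  have : ((1 - z : ℝ) : ℂ) ≠ 0 := ofReal_ne_zero.2 hz
  field_simp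

theorem sin_relation_ofReal {C : ℂ} {z : ℝ} (hz0 : 0 < z) (hz1 : z < 1)
    (h1 : -1 < C.re) (h2 : C.re < -1 / 3) :
    Complex.sin (3 * Real.pi * C) * I1Integral C z + Complex.sin (2 * Real.pi * C) * I3 C z +
      Complex.sin (Real.pi * C) * I2 C z = 0 := by
  rw [I1Integral_ofReal C hz1, I2_ofReal C hz0 hz1, I3_ofReal C hz0 hz1]
  exact sin_mul_integral_absCubicPow hz0 hz1 h1 h2

/-! ### Passage to complex `z`: uniform domination of the blocks -/

/-- Two holomorphic functions on a disc about a real point agree if they agree at real points. -/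
theorem eqOn_ball_of_eq_ofReal {f g : ℂ → ℂ} {a r : ℝ} (hr : 0 < r)
    (hf : DifferentiableOn ℂ f (ball (a : ℂ) r)) (hg : DifferentiableOn ℂ g (ball (a : ℂ) r))
    (h : ∀ x : ℝ, (x : ℂ) ∈ ball (a : ℂ) r → f x = g x) : EqOn f g (ball (a : ℂ) r) := by
  refine (hf.analyticOnNhd isOpen_ball).eqOn_of_preconnected_of_frequently_eq
    (hg.analyticOnNhd isOpen_ball) (convex_ball _ _).isPreconnected (mem_ball_self hr) ?_
  have ht : Tendsto (fun x : ℝ => (x : ℂ)) (𝓝[≠] a) (𝓝[≠] (a : ℂ)) := by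
    refine tendsto_nhdsWithin_iff.2 ⟨(continuous_ofReal.tendsto a).mono_left nhdsWithin_le_nhds, ?_⟩
    filter_upwards [self_mem_nhdsWithin] with x hx
    simpa using hx
  refine ht.frequently (Eventually.frequently ?_)
  have : ∀ᶠ x : ℝ in 𝓝[≠] a, (x : ℂ) ∈ ball (a : ℂ) r :=
    (ht.mono_right nhdsWithin_le_nhds).eventually (ball_mem_nhds _ hr)
  exact this.mono h

/-- A family of functions with values in the slit plane, holomorphic in the parameter and comparable
in modulus to a fixed function. -/
structure IsComparableFamily (U : Set ℂ) (S : Set ℝ) (a : ℝ → ℝ) (g : ℂ → ℝ → ℂ) : Prop where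
  measurableSet : MeasurableSet S
  measurable : ∀ z, Measurable (g z)
  mem_slitPlane : ∀ z ∈ U, ∀ t ∈ S, g z t ∈ slitPlane
  differentiableOn : ∀ t ∈ S, DifferentiableOn ℂ (g · t) U
  pos : ∀ t ∈ S, 0 < a t
  comparable : ∃ m M : ℝ, 0 < m ∧ 0 < M ∧
    ∀ z ∈ U, ∀ t ∈ S, m * a t ≤ ‖g z t‖ ∧ ‖g z t‖ ≤ M * a t

namespace IsComparableFamily

variable {U : Set ℂ} {S : Set ℝ} {a : ℝ → ℝ} {g : ℂ → ℝ → ℂ}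

theorem exists_norm_rpow_le (h : IsComparableFamily U S a g) (c : ℝ) :
    ∃ K : ℝ, ∀ z ∈ U, ∀ t ∈ S, ‖g z t‖ ^ c ≤ K * a t ^ c := by
  obtain ⟨m, M, hm, hM, hmM⟩ := h.comparable
  exact ⟨_, fun z hz t ht => rpow_le_mul_rpow_of_comparable c hm hM (h.pos t ht)
    (hmM z hz t ht).1 (hmM z hz t ht).2⟩

theorem exists_norm_cpow_le (h : IsComparableFamily U S a g) (C : ℂ) :
    ∃ K : ℝ, ∀ z ∈ U, ∀ t ∈ S, ‖g z t ^ C‖ ≤ K * a t ^ C.re := by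
  obtain ⟨K, hK⟩ := h.exists_norm_rpow_le C.re
  refine ⟨K * Real.exp (Real.pi * |C.im|), fun z hz t ht => ?_⟩
  refine (norm_cpow_le_rpow_mul_exp (slitPlane_ne_zero (h.mem_slitPlane z hz t ht)) C).trans ?_
  rw [mul_right_comm]
  exact mul_le_mul_of_nonneg_right (hK z hz t ht) (Real.exp_pos _).le

theorem integrableOn (h : IsComparableFamily U S a g) {C z : ℂ} (hz : z ∈ U)
    (ha : IntegrableOn (fun t => a t ^ C.re) S) : IntegrableOn (fun t => g z t ^ C) S := by
  obtain ⟨K, hK⟩ := h.exists_norm_cpow_le C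
  refine Integrable.mono' (ha.const_mul K) ((h.measurable z).pow_const C).aestronglyMeasurable ?_
  exact (ae_restrict_iff' h.measurableSet).2 (.of_forall fun t ht => hK z hz t ht)

theorem differentiableOn_integral (h : IsComparableFamily U S a g) (hU : IsOpen U) {C : ℂ}
    (ha : IntegrableOn (fun t => a t ^ C.re) S) :
    DifferentiableOn ℂ (fun z => ∫ t in S, g z t ^ C) U := by
  intro z hz
  obtain ⟨r, hr, hrU⟩ := Metric.isOpen_iff.1 hU z hz
  obtain ⟨K, hK⟩ := h.exists_norm_cpow_le C
  refine (differentiableAt_integral_of_dominated (F := fun z t => g z t ^ C) hr ?_ ?_ ?_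
    (ha.const_mul K)).differentiableWithinAt
  · exact fun w _ => ((h.measurable w).pow_const C).aestronglyMeasurable
  · refine (ae_restrict_iff' h.measurableSet).2 (.of_forall fun t ht => ?_)
    exact ((h.differentiableOn t ht).mono hrU).cpow_const
      fun w hw => h.mem_slitPlane w (hrU hw) t ht
  · exact (ae_restrict_iff' h.measurableSet).2
      (.of_forall fun t ht w hw => hK w (hrU hw) t ht)

theorem differentiableAt_integral (h : IsComparableFamily U S a g) {z : ℂ} (hz : z ∈ U)
    {c₁ c₂ : ℝ} (ha₁ : IntegrableOn (fun t => a t ^ c₁) S)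
    (ha₂ : IntegrableOn (fun t => a t ^ c₂) S) {C : ℂ} (h₁ : c₁ < C.re) (h₂ : C.re < c₂) :
    DifferentiableAt ℂ (fun C => ∫ t in S, g z t ^ C) C := by
  have key : ∀ c : ℝ, IntegrableOn (fun t => a t ^ c) S →
      IntegrableOn (fun t => ‖g z t‖ ^ c * ‖(1 : ℂ)‖) S := by
    intro c hc
    obtain ⟨K, hK⟩ := h.exists_norm_rpow_le c
    refine Integrable.mono' (hc.const_mul K)
      (((h.measurable z).norm.pow_const c).mul_const _).aestronglyMeasurable ?_
    refine (ae_restrict_iff' h.measurableSet).2 (.of_forall fun t ht => ?_)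
    rw [Real.norm_of_nonneg (by positivity), norm_one, mul_one]
    exact hK z hz t ht
  have hne : ∀ᵐ t ∂volume.restrict S, g z t ≠ 0 := (ae_restrict_iff' h.measurableSet).2
    (.of_forall fun t ht => slitPlane_ne_zero (h.mem_slitPlane z hz t ht))
  simpa using differentiableAt_integral_cpow (h := fun _ => 1) (h.measurable z).aemeasurable
    aestronglyMeasurable_const hne (key c₁ ha₁) (key c₂ ha₂) h₁ h₂

end IsComparableFamily

/-- The conditions on `z` near `1/2` that control the three conformal blocks. -/
structure NearHalf (z : ℂ) : Prop where
  norm_sub_lt : ‖z - 1 / 2‖ < 1 / 4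
  norm_lt : ‖z‖ < 1
  re_sq : 1 / 10 < (z ^ 2).re
  re_sq_mul : 1 / 10 < (z ^ 2 * (1 - z)).re
  re_one_sub_sq : 1 / 10 < ((1 - z) ^ 2).re
  re_one_sub_sq_mul : 1 / 10 < ((1 - z) ^ 2 * z).re

theorem eventually_nearHalf : ∀ᶠ z : ℂ in 𝓝 (1 / 2), NearHalf z := by
  have h1 : ∀ᶠ z : ℂ in 𝓝 (1 / 2), ‖z - 1 / 2‖ < 1 / 4 :=
    ContinuousAt.eventually_lt (by fun_prop) continuousAt_const (by norm_num)
  have h2 : ∀ᶠ z : ℂ in 𝓝 (1 / 2), ‖z‖ < 1 :=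
    ContinuousAt.eventually_lt (by fun_prop) continuousAt_const (by norm_num)
  -- At `z = 1/2` the four quantities are `1/4` or `1/8`, so `1/10` leaves room.
  have key : ∀ f : ℂ → ℂ, Continuous f → 1 / 10 < (f (1 / 2)).re →
      ∀ᶠ z : ℂ in 𝓝 (1 / 2), 1 / 10 < (f z).re := fun f hf h =>
    ContinuousAt.eventually_lt continuousAt_const (by fun_prop) h
  filter_upwards [h1, h2, key (fun z => z ^ 2) (by fun_prop) (by norm_num),
    key (fun z => z ^ 2 * (1 - z)) (by fun_prop) (by norm_num),
    key (fun z => (1 - z) ^ 2) (by fun_prop) (by norm_num),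
    key (fun z => (1 - z) ^ 2 * z) (by fun_prop) (by norm_num)] with z a b c d e f
  exact ⟨a, b, c, d, e, f⟩

theorem integrableOn_mul_one_sub_rpow {c : ℝ} (hc : -1 < c) :
    IntegrableOn (fun t : ℝ => (t * (1 - t)) ^ c) (Ioo 0 1) := by
  have h := (betaIntegral_convergent (u := (c + 1 : ℝ)) (v := (c + 1 : ℝ))
    (by simp; linarith) (by simp; linarith))
  rw [intervalIntegrable_iff_integrableOn_Ioo_of_le zero_le_one] at h
  refine IntegrableOn.congr_fun (f := fun t : ℝ => ‖(t : ℂ) ^ (((c + 1 : ℝ) : ℂ) - 1) *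
    (1 - (t : ℂ)) ^ (((c + 1 : ℝ) : ℂ) - 1)‖) h.norm (fun t ht => ?_) measurableSet_Ioo
  have h1 : 0 < 1 - t := sub_pos.2 ht.2
  have e : (((c + 1 : ℝ) : ℂ) - 1) = (c : ℂ) := by push_cast; ring
  have e' : ((1 : ℂ) - t) = ((1 - t : ℝ) : ℂ) := by push_cast; rfl
  simp only [e, e']
  rw [norm_mul, norm_cpow_eq_rpow_re_of_pos ht.1, norm_cpow_eq_rpow_re_of_pos h1,
    Real.mul_rpow ht.1.le h1.le, ofReal_re]

theorem integrableOn_cubic_rpow_Ioi {c : ℝ} (h1 : -1 < c) (h2 : c < -1 / 3) :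
    IntegrableOn (fun x : ℝ => (x * (x - 1) * (x - 1 / 2)) ^ c) (Ioi 1) := by
  refine (integrable_cubic_rpow (z := 1 / 2) (by norm_num) (by norm_num) h1 h2).integrableOn.congr_fun
    (fun x hx => ?_) measurableSet_Ioi
  have hx' : 1 < x := hx
  have ha : 0 ≤ x := by linarith
  have hb : 0 ≤ x - 1 := by linarith
  have hd : 0 ≤ x - 1 / 2 := by linarith
  rw [Real.mul_rpow (mul_nonneg ha hb) hd, Real.mul_rpow ha hb]
  simp only [abs_of_nonneg ha, abs_of_nonneg hb, abs_of_nonneg hd]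

/-- Replacing `z` by `1/2` changes the last factor by less than `1/4`, which is less than half of `x
- 1/2` for `x > 1`; hence the constants `1/2` and `2`. -/
theorem comparable_I1 {U : Set ℂ} (hU : ∀ z ∈ U, NearHalf z) :
    IsComparableFamily U (Ioi 1) (fun x => x * (x - 1) * (x - 1 / 2)) (fun z x => Q z x) where
  measurableSet := measurableSet_Ioi
  measurable z := by unfold Q; fun_prop
  mem_slitPlane z hz x hx := by
    have hx' : 1 < x := hx
    left
    have e : Q z x = ((x * (x - 1) : ℝ) : ℂ) * (x - z) := by simp only [Q]; push_cast; ring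
    have h := (hU z hz).norm_sub_lt
    have h2 := (abs_lt.1 ((abs_re_le_norm (z - 1 / 2)).trans_lt h)).2
    rw [e, re_ofReal_mul]
    simp at h2
    refine mul_pos (mul_pos (by linarith) (by linarith)) ?_
    simp
    linarith
  differentiableOn x _ := by unfold Q; fun_prop
  pos x hx := by
    have hx' : 1 < x := hx
    exact mul_pos (mul_pos (by linarith) (by linarith)) (by linarith)
  comparable := by
    refine ⟨1 / 2, 2, by norm_num, by norm_num, fun z hz x hx => ?_⟩
    have hx' : 1 < x := hx
    have e : Q z x = ((x * (x - 1) : ℝ) : ℂ) * (((x - 1 / 2 : ℝ) : ℂ) - (z - 1 / 2)) := by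
      simp only [Q]; push_cast; ring
    have h := (hU z hz).norm_sub_lt
    have hp : 0 < x * (x - 1) := mul_pos (by linarith) (by linarith)
    have hq : 0 < x - 1 / 2 := by linarith
    have h1 := norm_sub_norm_le (((x - 1 / 2 : ℝ) : ℂ)) (z - 1 / 2)
    have h2 := norm_sub_le (((x - 1 / 2 : ℝ) : ℂ)) (z - 1 / 2)
    rw [norm_real, Real.norm_of_nonneg hq.le] at h1 h2
    rw [e, norm_mul, norm_real, Real.norm_of_nonneg hp.le]
    constructor
    · nlinarith
    · nlinarith

/-- After splitting off `t (1 - t)`, the cofactor `z² (1 - tz)` is affine in `t`. Its real part is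
therefore controlled by the endpoint values `z²` and `z² (1 - z)`, the ones bounded below in
`NearHalf`. -/
theorem comparable_I2 {U : Set ℂ} (hU : ∀ z ∈ U, NearHalf z) :
    IsComparableFamily U (Ioo 0 1) (fun t => t * (1 - t)) (fun z t => Q z (t * z)) := by
  have e : ∀ (z : ℂ) (t : ℝ), Q z (t * z) = ((t * (1 - t) : ℝ) : ℂ) * (z ^ 2 * (1 - t * z)) := by
    intro z t; simp only [Q]; push_cast; ring
  have hre : ∀ z ∈ U, ∀ t ∈ Ioo (0 : ℝ) 1, 1 / 10 < (z ^ 2 * (1 - t * z)).re := by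
    intro z hz t ht
    have e' : z ^ 2 * (1 - t * z) = ((1 - t : ℝ) : ℂ) * z ^ 2 + (t : ℂ) * (z ^ 2 * (1 - z)) := by
      push_cast; ring
    rw [e', add_re, re_ofReal_mul, re_ofReal_mul]
    nlinarith [(hU z hz).re_sq, (hU z hz).re_sq_mul, ht.1, ht.2]
  refine ⟨measurableSet_Ioo, fun z => by unfold Q; fun_prop, fun z hz t ht => Or.inl ?_,
    fun t _ => by unfold Q; fun_prop, fun t ht => mul_pos ht.1 (sub_pos.2 ht.2),
    1 / 10, 2, by norm_num, by norm_num, fun z hz t ht => ?_⟩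
  · simp only [e, re_ofReal_mul]
    exact mul_pos (mul_pos ht.1 (sub_pos.2 ht.2)) (by linarith [hre z hz t ht])
  · have hp : 0 < t * (1 - t) := mul_pos ht.1 (sub_pos.2 ht.2)
    simp only [e]
    rw [norm_mul, norm_real, Real.norm_of_nonneg hp.le, mul_comm (t * (1 - t))]
    refine ⟨mul_le_mul_of_nonneg_right ((hre z hz t ht).le.trans (re_le_norm _)) hp.le,
      mul_le_mul_of_nonneg_right ?_ hp.le⟩
    have hz1 := (hU z hz).norm_lt.le
    have h1 : ‖(1 : ℂ) - t * z‖ ≤ 2 := by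
      refine (norm_sub_le _ _).trans ?_
      rw [norm_one, norm_mul, norm_real, Real.norm_of_nonneg ht.1.le]
      nlinarith [ht.1, ht.2, norm_nonneg z]
    rw [norm_mul, norm_pow]
    calc ‖z‖ ^ 2 * ‖(1 : ℂ) - t * z‖ ≤ 1 ^ 2 * 2 := by gcongr
      _ = 2 := by norm_num

/-- The same device as for `comparable_I2`: the cofactor of `t (1 - t)` is affine in `t`, with
endpoint values `(1 - z)² z` and `(1 - z)²`. -/
theorem comparable_I3 {U : Set ℂ} (hU : ∀ z ∈ U, NearHalf z) :
    IsComparableFamily U (Ioo 0 1) (fun t => t * (1 - t)) (fun z t => -Q z (z + t * (1 - z))) := by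
  have e : ∀ (z : ℂ) (t : ℝ), -Q z (z + t * (1 - z)) =
      ((t * (1 - t) : ℝ) : ℂ) * ((1 - z) ^ 2 * (z + t * (1 - z))) := by
    intro z t; simp only [Q]; push_cast; ring
  have hre : ∀ z ∈ U, ∀ t ∈ Ioo (0 : ℝ) 1, 1 / 10 < ((1 - z) ^ 2 * (z + t * (1 - z))).re := by
    intro z hz t ht
    have e' : (1 - z) ^ 2 * (z + t * (1 - z)) =
        ((1 - t : ℝ) : ℂ) * ((1 - z) ^ 2 * z) + (t : ℂ) * (1 - z) ^ 2 := by
      push_cast; ring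
    rw [e', add_re, re_ofReal_mul, re_ofReal_mul]
    nlinarith [(hU z hz).re_one_sub_sq, (hU z hz).re_one_sub_sq_mul, ht.1, ht.2]
  refine ⟨measurableSet_Ioo, fun z => by unfold Q; fun_prop, fun z hz t ht => Or.inl ?_,
    fun t _ => by unfold Q; fun_prop, fun t ht => mul_pos ht.1 (sub_pos.2 ht.2),
    1 / 10, 8, by norm_num, by norm_num, fun z hz t ht => ?_⟩
  · simp only [e, re_ofReal_mul]
    exact mul_pos (mul_pos ht.1 (sub_pos.2 ht.2)) (by linarith [hre z hz t ht])
  · have hp : 0 < t * (1 - t) := mul_pos ht.1 (sub_pos.2 ht.2)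
    simp only [e]
    rw [norm_mul, norm_real, Real.norm_of_nonneg hp.le, mul_comm (t * (1 - t))]
    refine ⟨mul_le_mul_of_nonneg_right ((hre z hz t ht).le.trans (re_le_norm _)) hp.le,
      mul_le_mul_of_nonneg_right ?_ hp.le⟩
    have hz1 := (hU z hz).norm_lt.le
    have h0 : ‖(1 : ℂ) - z‖ ≤ 2 := by
      refine (norm_sub_le _ _).trans ?_
      rw [norm_one]
      linarith
    have h1 : ‖z + t * (1 - z)‖ ≤ 2 := by
      have : z + t * (1 - z) = ((1 - t : ℝ) : ℂ) * z + (t : ℂ) := by push_cast; ring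
      rw [this]
      refine (norm_add_le _ _).trans ?_
      rw [norm_mul, norm_real, norm_real, Real.norm_of_nonneg ht.1.le,
        Real.norm_of_nonneg (sub_pos.2 ht.2).le]
      nlinarith [ht.1, ht.2, norm_nonneg z]
    rw [norm_mul, norm_pow]
    calc ‖(1 : ℂ) - z‖ ^ 2 * ‖z + t * (1 - z)‖ ≤ 2 ^ 2 * 2 := by gcongr
      _ = 8 := by norm_num

theorem I2_eq_setIntegral (C z : ℂ) : I2 C z = (∫ t in Ioo (0 : ℝ) 1, Q z (t * z) ^ C) * z := by
  rw [I2, intervalIntegral.integral_mul_const, intervalIntegral.integral_of_le zero_le_one,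
    integral_Ioc_eq_integral_Ioo]

theorem I3_eq_setIntegral (C z : ℂ) :
    I3 C z = (∫ t in Ioo (0 : ℝ) 1, (-Q z (z + t * (1 - z))) ^ C) * (1 - z) := by
  rw [I3, intervalIntegral.integral_mul_const, intervalIntegral.integral_of_le zero_le_one,
    integral_Ioc_eq_integral_Ioo]

section

variable {C z : ℂ}

theorem integrableOn_I1 (hz : NearHalf z) (h1 : -1 < C.re) (h2 : C.re < -1 / 3) :
    IntegrableOn (fun w : ℝ => Q z w ^ C) (Ioi 1) :=
  (comparable_I1 (U := {z}) (by simpa)).integrableOn rfl (integrableOn_cubic_rpow_Ioi h1 h2)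

theorem intervalIntegrable_I2 (hz : NearHalf z) (h1 : -1 < C.re) :
    IntervalIntegrable (fun t : ℝ => Q z (t * z) ^ C * z) volume 0 1 := by
  rw [intervalIntegrable_iff_integrableOn_Ioo_of_le zero_le_one]
  exact ((comparable_I2 (U := {z}) (by simpa)).integrableOn rfl
    (integrableOn_mul_one_sub_rpow h1)).mul_const z

theorem differentiableAt_I1Integral (hz : NearHalf z) (h1 : -1 < C.re) (h2 : C.re < -1 / 3) :
    DifferentiableAt ℂ (fun C => I1Integral C z) C := by
  obtain ⟨c₁, h11, h12⟩ := exists_between h1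
  obtain ⟨c₂, h21, h22⟩ := exists_between h2
  exact (comparable_I1 (U := {z}) (by simpa)).differentiableAt_integral rfl
    (integrableOn_cubic_rpow_Ioi h11 (by linarith)) (integrableOn_cubic_rpow_Ioi (by linarith) h22)
    h12 h21

theorem differentiableAt_I2 (hz : NearHalf z) (h1 : -1 < C.re) :
    DifferentiableAt ℂ (fun C => I2 C z) C := by
  obtain ⟨c₁, h11, h12⟩ := exists_between h1
  simp only [I2_eq_setIntegral]
  exact ((comparable_I2 (U := {z}) (by simpa)).differentiableAt_integral rfl
    (integrableOn_mul_one_sub_rpow h11) (integrableOn_mul_one_sub_rpow (c := C.re + 1) (by linarith))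
    h12 (by linarith)).mul_const z

theorem differentiableAt_I3 (hz : NearHalf z) (h1 : -1 < C.re) :
    DifferentiableAt ℂ (fun C => I3 C z) C := by
  obtain ⟨c₁, h11, h12⟩ := exists_between h1
  simp only [I3_eq_setIntegral]
  exact ((comparable_I3 (U := {z}) (by simpa)).differentiableAt_integral rfl
    (integrableOn_mul_one_sub_rpow h11) (integrableOn_mul_one_sub_rpow (c := C.re + 1) (by linarith))
    h12 (by linarith)).mul_const (1 - z)

theorem differentiableOn_I1Integral {U : Set ℂ} (hU : ∀ z ∈ U, NearHalf z) (hUo : IsOpen U)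
    (h1 : -1 < C.re) (h2 : C.re < -1 / 3) :
    DifferentiableOn ℂ (fun z => I1Integral C z) U :=
  (comparable_I1 hU).differentiableOn_integral hUo (integrableOn_cubic_rpow_Ioi h1 h2)

theorem differentiableOn_I2 {U : Set ℂ} (hU : ∀ z ∈ U, NearHalf z) (hUo : IsOpen U)
    (h1 : -1 < C.re) : DifferentiableOn ℂ (fun z => I2 C z) U := by
  simp only [I2_eq_setIntegral]
  exact ((comparable_I2 hU).differentiableOn_integral hUo
    (integrableOn_mul_one_sub_rpow h1)).mul differentiableOn_id

theorem differentiableOn_I3 {U : Set ℂ} (hU : ∀ z ∈ U, NearHalf z) (hUo : IsOpen U)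
    (h1 : -1 < C.re) : DifferentiableOn ℂ (fun z => I3 C z) U := by
  simp only [I3_eq_setIntegral]
  exact ((comparable_I3 hU).differentiableOn_integral hUo
    (integrableOn_mul_one_sub_rpow h1)).mul (by fun_prop)

end

/-! ### The sine relation for complex `z` -/

/-- The relation between the three conformal blocks in the strip of convergence. -/
theorem sin_relation {r : ℝ} (hr : 0 < r) (hU : ∀ z ∈ ball ((1 / 2 : ℝ) : ℂ) r, NearHalf z) {C z : ℂ}
    (hz : z ∈ ball ((1 / 2 : ℝ) : ℂ) r) (h1 : -1 < C.re) (h2 : C.re < -1 / 3) :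
    Complex.sin (3 * Real.pi * C) * I1Integral C z + Complex.sin (2 * Real.pi * C) * I3 C z +
      Complex.sin (Real.pi * C) * I2 C z = 0 := by
  refine eqOn_ball_of_eq_ofReal (f := fun z => Complex.sin (3 * Real.pi * C) * I1Integral C z +
    Complex.sin (2 * Real.pi * C) * I3 C z + Complex.sin (Real.pi * C) * I2 C z)
    (g := fun _ => 0) hr ?_ (differentiableOn_const _) ?_ hz
  · exact (((differentiableOn_I1Integral hU isOpen_ball h1 h2).const_mul _).add
      ((differentiableOn_I3 hU isOpen_ball h1).const_mul _)).add
      ((differentiableOn_I2 hU isOpen_ball h1).const_mul _)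
  · intro x hx
    have h := (abs_lt.1 ((abs_re_le_norm ((x : ℂ) - 1 / 2)).trans_lt (hU x hx).norm_sub_lt))
    simp at h
    exact sin_relation_ofReal (by linarith) (by linarith) h1 h2

/-! ### Principal square root and complex `arccos` -/

theorem cpow_half_sq (w : ℂ) : (w ^ (1 / 2 : ℂ)) ^ 2 = w := by
  rw [one_div]
  exact cpow_ofNat_inv_pow w 2

theorem cpow_half_eq {w y : ℂ} (hy : 0 < y.re) (h : y ^ 2 = w) : w ^ (1 / 2 : ℂ) = y := by
  rw [← h, one_div]
  exact sq_cpow_two_inv hy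

theorem re_cpow_half_pos {w : ℂ} (hw : w ∈ slitPlane) : 0 < (w ^ (1 / 2 : ℂ)).re := by
  have h := mem_slitPlane_iff_arg.1 hw
  have hpi := abs_arg_le_pi w
  rw [cpow_def_of_ne_zero h.2, exp_re]
  refine mul_pos (Real.exp_pos _) (Real.cos_pos_of_mem_Ioo ?_)
  have e : (Complex.log w * (1 / 2)).im = w.arg / 2 := by
    rw [show (1 / 2 : ℂ) = ((1 / 2 : ℝ) : ℂ) by norm_num, im_mul_ofReal, log_im]
    ring
  have h1 := neg_pi_lt_arg w
  have h2 := lt_of_le_of_ne (arg_le_pi w) h.1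
  rw [e]
  constructor <;> linarith

theorem one_sub_sq_mem_slitPlane {x : ℂ} (hx : |x.re| < 1) : 1 - x ^ 2 ∈ slitPlane := by
  have h := abs_lt.1 hx
  by_cases h0 : x.re * x.im = 0
  · left
    have : (1 - x ^ 2).re = 1 - x.re ^ 2 + x.im ^ 2 := by
      simp [pow_two]
      ring
    rw [this]
    nlinarith [sq_nonneg x.im]
  · right
    have : (1 - x ^ 2).im = -(2 * (x.re * x.im)) := by
      simp [pow_two]
      ring
    rw [this]
    simpa using h0

theorem add_mul_sub_cpow_half (x : ℂ) :
    (x + I * (1 - x ^ 2) ^ (1 / 2 : ℂ)) * (x - I * (1 - x ^ 2) ^ (1 / 2 : ℂ)) = 1 := by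
  have h := cpow_half_sq (1 - x ^ 2)
  linear_combination h - ((1 - x ^ 2) ^ (1 / 2 : ℂ)) ^ 2 * I_sq

/-- With `y` the square root, `x + iy` and `x - iy` are mutually inverse. If the first were real so
would be the second, and then `Re y = 0`, whereas the principal root has positive real part here. -/
theorem add_I_mul_cpow_half_mem_slitPlane {x : ℂ} (hx : |x.re| < 1) :
    x + I * (1 - x ^ 2) ^ (1 / 2 : ℂ) ∈ slitPlane := by
  have hy := re_cpow_half_pos (one_sub_sq_mem_slitPlane hx)
  have hm := add_mul_sub_cpow_half x
  generalize (1 - x ^ 2) ^ (1 / 2 : ℂ) = y at *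
  right
  intro h0
  have him := congrArg im hm
  have hre := congrArg re hm
  rw [mul_im, h0] at him
  rw [mul_re, h0] at hre
  simp only [zero_mul, add_zero, sub_zero, one_im, one_re] at him hre
  have h1 : (x - I * y).im = 0 :=
    (mul_eq_zero.1 him).resolve_left (left_ne_zero_of_mul_eq_one hre)
  simp at h0 h1
  linarith

theorem differentiableAt_arccos {x : ℂ} (hx : |x.re| < 1) : DifferentiableAt ℂ arccos x := by
  have h : DifferentiableAt ℂ (fun x : ℂ => x + I * (1 - x ^ 2) ^ (1 / 2 : ℂ)) x := by
    refine differentiableAt_id.add (DifferentiableAt.const_mul ?_ _)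
    exact DifferentiableAt.cpow_const (by fun_prop) (one_sub_sq_mem_slitPlane hx)
  exact (h.clog (add_I_mul_cpow_half_mem_slitPlane hx)).const_mul (-I)

theorem exp_I_mul_arccos (x : ℂ) :
    exp (arccos x * I) = x + I * (1 - x ^ 2) ^ (1 / 2 : ℂ) := by
  have : arccos x * I = Complex.log (x + I * (1 - x ^ 2) ^ (1 / 2 : ℂ)) := by
    rw [arccos]
    linear_combination (-Complex.log (x + I * (1 - x ^ 2) ^ (1 / 2 : ℂ))) * I_sq
  rw [this, exp_log]
  exact left_ne_zero_of_mul_eq_one (add_mul_sub_cpow_half x)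

theorem exp_neg_I_mul_arccos (x : ℂ) :
    exp (-arccos x * I) = x - I * (1 - x ^ 2) ^ (1 / 2 : ℂ) := by
  rw [neg_mul, Complex.exp_neg, exp_I_mul_arccos]
  exact inv_eq_of_mul_eq_one_right (add_mul_sub_cpow_half x)

theorem cos_arccos (x : ℂ) : Complex.cos (arccos x) = x := by
  rw [Complex.cos, exp_I_mul_arccos, exp_neg_I_mul_arccos]
  ring

theorem sin_arccos (x : ℂ) : Complex.sin (arccos x) = (1 - x ^ 2) ^ (1 / 2 : ℂ) := by
  rw [Complex.sin, exp_I_mul_arccos, exp_neg_I_mul_arccos]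
  linear_combination (-(1 - x ^ 2) ^ (1 / 2 : ℂ)) * I_sq

theorem arccos_cos {t : ℝ} (h0 : 0 < t) (h1 : t < Real.pi) : arccos (Real.cos t : ℂ) = t := by
  have hs : (1 - (Real.cos t : ℂ) ^ 2) ^ (1 / 2 : ℂ) = (Real.sin t : ℂ) := by
    refine cpow_half_eq ?_ ?_
    · rw [ofReal_re]
      exact Real.sin_pos_of_pos_of_lt_pi h0 h1
    · rw [eq_sub_iff_add_eq]
      exact_mod_cast Real.sin_sq_add_cos_sq t
  have he : (Real.cos t : ℂ) + I * (Real.sin t : ℂ) = exp (t * I) := by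
    rw [exp_mul_I]
    push_cast
    ring
  rw [arccos, hs, he, log_exp (by simp; linarith) (by simp; linarith)]
  linear_combination (-(t : ℂ)) * I_sq

/-! ### The roots of the cubic in trigonometric form -/

/-- The square root of the discriminant of `Q'`. -/
noncomputable def sqrtDisc (z : ℂ) : ℂ := (z ^ 2 - z + 1) ^ (1 / 2 : ℂ)

/-- The argument of `arccos` in the solutions of the cubic equation. -/
noncomputable def cosArg (q z : ℂ) : ℂ := 3 * v q z / (2 * u z) * (-3 / u z) ^ (1 / 2 : ℂ)

theorem sqrtDisc_sq (z : ℂ) : sqrtDisc z ^ 2 = z ^ 2 - z + 1 := cpow_half_sq _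

theorem u_eq (z : ℂ) : u z = -(sqrtDisc z ^ 2) / 3 := by
  rw [sqrtDisc_sq, u]
  ring

theorem wPlus_eq (z : ℂ) : wPlus z = (z + 1) / 3 + sqrtDisc z / 3 := rfl

theorem angle_eq (q z : ℂ) : angle q z = arccos (cosArg q z) / 3 := rfl

theorem cpow_neg_u_div (z : ℂ) (hz : 0 < (sqrtDisc z).re) :
    (-u z / 3) ^ (1 / 2 : ℂ) = sqrtDisc z / 3 := by
  refine cpow_half_eq ?_ ?_
  · rw [show sqrtDisc z / 3 = sqrtDisc z / ((3 : ℝ) : ℂ) by norm_num, div_ofReal_re]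
    positivity
  · rw [u_eq]
    ring

theorem cpow_neg_three_div_u (z : ℂ) (hz : 0 < (sqrtDisc z).re) :
    (-3 / u z) ^ (1 / 2 : ℂ) = 3 / sqrtDisc z := by
  have hne : sqrtDisc z ≠ 0 := by
    intro h
    simp [h] at hz
  refine cpow_half_eq ?_ ?_
  · rw [show (3 : ℂ) / sqrtDisc z = ((3 : ℝ) : ℂ) * (sqrtDisc z)⁻¹ by rw [div_eq_mul_inv]; norm_num,
      re_ofReal_mul, inv_re]
    have := normSq_pos.2 hne
    positivity
  · rw [u_eq]
    field_simp

theorem cosArg_eq (q z : ℂ) (hz : 0 < (sqrtDisc z).re) :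
    cosArg q z = -(27 * v q z) / (2 * sqrtDisc z ^ 3) := by
  have hne : sqrtDisc z ≠ 0 := by
    intro h
    simp [h] at hz
  rw [cosArg, cpow_neg_three_div_u z hz, u_eq]
  field_simp
  ring

/-- The cubic in the coordinate in which it becomes a Chebyshev polynomial. -/
theorem Q_chebyshev (z x : ℂ) (hz : 0 < (sqrtDisc z).re) :
    Q z ((z + 1) / 3 + 2 * (sqrtDisc z / 3) * x) =
      2 * sqrtDisc z ^ 3 / 27 * (4 * x ^ 3 - 3 * x - cosArg 0 z) := by
  have hne : sqrtDisc z ≠ 0 := by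
    intro h
    simp [h] at hz
  have h2 := sqrtDisc_sq z
  rw [cosArg_eq 0 z hz]
  have e : 2 * sqrtDisc z ^ 3 / 27 * (4 * x ^ 3 - 3 * x - -(27 * v 0 z) / (2 * sqrtDisc z ^ 3)) =
      2 * sqrtDisc z ^ 3 / 27 * (4 * x ^ 3 - 3 * x) + v 0 z := by
    field_simp
    ring
  rw [e, Q, v]
  generalize sqrtDisc z = s at *
  linear_combination (2 * x * s / 9) * h2

/-- The argument of `arccos` is affine in `q`. Together with `Q_chebyshev`, solving `Q = q` becomes
solving `4x³ - 3x = cosArg q z`. -/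
theorem cosArg_eq_add (q z : ℂ) (hz : 0 < (sqrtDisc z).re) :
    2 * sqrtDisc z ^ 3 / 27 * (cosArg q z - cosArg 0 z) = q := by
  have hne : sqrtDisc z ≠ 0 := by
    intro h
    simp [h] at hz
  rw [cosArg_eq 0 z hz, cosArg_eq q z hz, v, v]
  field_simp
  ring

/-- The critical point is `x = 1/2` in the Chebyshev coordinate, where `4x³ - 3x = -1`. -/
theorem QPlus_eq (z : ℂ) (hz : 0 < (sqrtDisc z).re) :
    QPlus z = -(2 * sqrtDisc z ^ 3 / 27 * (1 + cosArg 0 z)) := by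
  have h := Q_chebyshev z (1 / 2) hz
  rw [show 2 * (sqrtDisc z / 3) * (1 / 2) = sqrtDisc z / 3 by ring, ← wPlus_eq, ← QPlus] at h
  rw [h]
  ring

/-- For `τ` from `0` to `1` this is the segment from `cosArg 0 z` to the branch point `-1` of
`arccos`, reached at `τ = 1`, that is `ζ = 0`. -/
theorem cosArg_QPlus_mul (z τ : ℂ) (hz : 0 < (sqrtDisc z).re) :
    cosArg (QPlus z * τ) z = cosArg 0 z - τ * (1 + cosArg 0 z) := by
  have hne : sqrtDisc z ≠ 0 := by
    intro h
    simp [h] at hz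
  have h := cosArg_eq_add (QPlus z * τ) z hz
  rw [QPlus_eq z hz] at h ⊢
  have hk : 2 * sqrtDisc z ^ 3 / 27 ≠ 0 := by simp [hne]
  refine mul_left_cancel₀ hk ?_
  linear_combination h

theorem cos_two_pi_div_three : Complex.cos (2 * Real.pi / 3) = -1 / 2 := by
  have : Real.cos (2 * Real.pi / 3) = -1 / 2 := by
    rw [show 2 * Real.pi / 3 = Real.pi - Real.pi / 3 by ring, Real.cos_pi_sub, Real.cos_pi_div_three]
    ring
  have h := congrArg (fun x : ℝ => (x : ℂ)) this
  push_cast at h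
  exact h

theorem sin_two_pi_div_three : Complex.sin (2 * Real.pi / 3) = (Real.sqrt 3 : ℂ) / 2 := by
  have : Real.sin (2 * Real.pi / 3) = Real.sqrt 3 / 2 := by
    rw [show 2 * Real.pi / 3 = Real.pi - Real.pi / 3 by ring, Real.sin_pi_sub, Real.sin_pi_div_three]
  have h := congrArg (fun x : ℝ => (x : ℂ)) this
  push_cast at h
  exact h

theorem ofReal_sqrt_three_sq : (Real.sqrt 3 : ℂ) ^ 2 = 3 := by
  have := Real.sq_sqrt (show (0 : ℝ) ≤ 3 by norm_num)
  exact_mod_cast this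

/-- The three roots are equally spaced in angle, so the product of their differences is a multiple
of `sin 3θ`, and `3θ` is the `arccos`. -/
theorem sub_mul_sub_mul_sub_eq {q z : ℂ} (hz : 0 < (sqrtDisc z).re) :
    (w0 q z - w1 q z) * (w0 q z - w2 q z) * (w1 q z - w2 q z) =
      (2 * (sqrtDisc z / 3)) ^ 3 * (3 * Real.sqrt 3 / 4) * (1 - cosArg q z ^ 2) ^ (1 / 2 : ℂ) := by
  have hs := sin_arccos (cosArg q z)
  have e3 : arccos (cosArg q z) = 3 * angle q z := by rw [angle_eq]; ring
  rw [← hs, e3, Complex.sin_three_mul, w0, w1, w2, cpow_neg_u_div z hz, Complex.cos_add,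
    Complex.cos_sub, cos_two_pi_div_three, sin_two_pi_div_three]
  have h1 := Complex.sin_sq_add_cos_sq (angle q z)
  have h3 := ofReal_sqrt_three_sq
  generalize (Real.sqrt 3 : ℂ) = t at *
  generalize Complex.sin (angle q z) = b at *
  generalize Complex.cos (angle q z) = a at *
  linear_combination (2 * (sqrtDisc z / 3)) ^ 3 * (t * b * 9 / 4 * h1) -
    (2 * (sqrtDisc z / 3)) ^ 3 * t * b ^ 3 / 4 * h3

theorem w1_add_w2_sub_two_mul_w0 {q z : ℂ} (hz : 0 < (sqrtDisc z).re) :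
    w1 q z + w2 q z - 2 * w0 q z =
      2 * (sqrtDisc z / 3) * (-3 * Complex.cos (angle q z + 2 * Real.pi / 3)) := by
  rw [w0, w1, w2, cpow_neg_u_div z hz, Complex.cos_add, Complex.cos_sub, cos_two_pi_div_three,
    sin_two_pi_div_three]
  ring

/-- The derivative of `Q` in `w`. -/
def Q' (z w : ℂ) : ℂ := 3 * w ^ 2 - 2 * (z + 1) * w + z

theorem Q'_w1 {q z : ℂ} (hz : 0 < (sqrtDisc z).re) :
    Q' z (w1 q z) = (w1 q z - w0 q z) * (w1 q z - w2 q z) := by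
  rw [Q', w0, w1, w2, cpow_neg_u_div z hz, Complex.cos_add, Complex.cos_sub, cos_two_pi_div_three,
    sin_two_pi_div_three]
  have h1 := Complex.sin_sq_add_cos_sq (angle q z)
  have h3 := ofReal_sqrt_three_sq
  have h2 := sqrtDisc_sq z
  generalize (Real.sqrt 3 : ℂ) = t at *
  generalize Complex.sin (angle q z) = b at *
  generalize Complex.cos (angle q z) = a at *
  generalize sqrtDisc z = s at *
  linear_combination (1 / 3) * h2 + s ^ 2 / 3 * h1 + s ^ 2 * b ^ 2 / 9 * h3

theorem Q'_w2 {q z : ℂ} (hz : 0 < (sqrtDisc z).re) :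
    Q' z (w2 q z) = (w2 q z - w0 q z) * (w2 q z - w1 q z) := by
  rw [Q', w0, w1, w2, cpow_neg_u_div z hz, Complex.cos_add, Complex.cos_sub, cos_two_pi_div_three,
    sin_two_pi_div_three]
  have h1 := Complex.sin_sq_add_cos_sq (angle q z)
  have h3 := ofReal_sqrt_three_sq
  have h2 := sqrtDisc_sq z
  generalize (Real.sqrt 3 : ℂ) = t at *
  generalize Complex.sin (angle q z) = b at *
  generalize Complex.cos (angle q z) = a at *
  generalize sqrtDisc z = s at *
  linear_combination (1 / 3) * h2 + s ^ 2 / 3 * h1 + s ^ 2 * b ^ 2 / 9 * h3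

/-- Since `Q' = (w₁ - w₀)(w₁ - w₂)` at `w₁`, and likewise at `w₂`, this is a partial fraction
identity. It explains the shape of `Φ`: along `q = Q₊ e^{-ζ}` one has `dw = -(q / Q'(w)) dζ` on each
branch. -/
theorem Phi_eq_sub {q z : ℂ} (hz : 0 < (sqrtDisc z).re) (hq : 1 - cosArg q z ^ 2 ≠ 0) :
    Phi q z = q / Q' z (w1 q z) - q / Q' z (w2 q z) := by
  have hne : sqrtDisc z ≠ 0 := by
    intro h
    simp [h] at hz
  have h := sub_mul_sub_mul_sub_eq (q := q) hz
  have h0 : (w0 q z - w1 q z) * (w0 q z - w2 q z) * (w1 q z - w2 q z) ≠ 0 := by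
    rw [h]
    have h3 : (Real.sqrt 3 : ℂ) ≠ 0 := by
      rw [ofReal_ne_zero]
      positivity
    have hy : (1 - cosArg q z ^ 2) ^ (1 / 2 : ℂ) ≠ 0 := by
      intro h0
      have := cpow_half_sq (1 - cosArg q z ^ 2)
      rw [h0] at this
      exact hq (by rw [← this]; ring)
    simp [h3, hne]
    simpa using hy
  rw [Q'_w1 hz, Q'_w2 hz, Phi]
  have h01 : w0 q z - w1 q z ≠ 0 := left_ne_zero_of_mul (left_ne_zero_of_mul h0)
  have h02 : w0 q z - w2 q z ≠ 0 := right_ne_zero_of_mul (left_ne_zero_of_mul h0)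
  have h12 : w1 q z - w2 q z ≠ 0 := right_ne_zero_of_mul h0
  have h10 : w1 q z - w0 q z ≠ 0 := by rwa [← neg_sub, neg_ne_zero]
  have h20 : w2 q z - w0 q z ≠ 0 := by rwa [← neg_sub, neg_ne_zero]
  have h21 : w2 q z - w1 q z ≠ 0 := by rwa [← neg_sub, neg_ne_zero]
  rw [← neg_sub (w1 q z) (w0 q z), ← neg_sub (w2 q z) (w0 q z), ← neg_sub (w1 q z) (w2 q z)]
  rw [← neg_sub (w1 q z) (w2 q z)] at h21
  field_simp
  ring

/-! ### Control of the Borel germ along the segment from `Q₊` to `0` -/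

/-- The conditions on `z` near `1/2` that control the roots of the cubic over the segment between
the critical value and `0`. -/
structure RootsControlled (z : ℂ) : Prop where
  re_disc : 1 / 2 < (z ^ 2 - z + 1).re
  norm_cosArg : ‖cosArg 0 z‖ < 1 / 2
  norm_QPlus : ‖QPlus z‖ < 1
  re_neg_QPlus : 0 < (-QPlus z).re

theorem differentiableAt_sqrtDisc {z : ℂ} (hz : 0 < (z ^ 2 - z + 1).re) :
    DifferentiableAt ℂ sqrtDisc z := by
  unfold sqrtDisc
  exact DifferentiableAt.cpow_const (by fun_prop) (Or.inl hz)

theorem re_sqrtDisc_pos {z : ℂ} (hz : 0 < (z ^ 2 - z + 1).re) : 0 < (sqrtDisc z).re :=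
  re_cpow_half_pos (Or.inl hz)

theorem differentiableAt_QPlus {z : ℂ} (hz : 0 < (z ^ 2 - z + 1).re) :
    DifferentiableAt ℂ QPlus z := by
  have h := differentiableAt_sqrtDisc hz
  have : QPlus = fun z => Q z ((z + 1) / 3 + sqrtDisc z / 3) := rfl
  rw [this]
  unfold Q
  fun_prop

theorem differentiableAt_cosArg {z : ℂ} (hz : 0 < (z ^ 2 - z + 1).re) :
    DifferentiableAt ℂ (cosArg 0) z := by
  have hs := differentiableAt_sqrtDisc hz
  have hne : sqrtDisc z ≠ 0 := by
    intro h
    have := re_sqrtDisc_pos hz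
    simp [h] at this
  have hd : DifferentiableAt ℂ (fun z => -(27 * v 0 z) / (2 * sqrtDisc z ^ 3)) z := by
    unfold v
    refine DifferentiableAt.div (by fun_prop) (by fun_prop) (by simp [hne])
  refine hd.congr_of_eventuallyEq ?_
  have : ∀ᶠ w : ℂ in 𝓝 z, 0 < (w ^ 2 - w + 1).re :=
    ContinuousAt.eventually_lt continuousAt_const (by fun_prop) hz
  filter_upwards [this] with w hw
  exact cosArg_eq 0 w (re_sqrtDisc_pos hw)

theorem sqrtDisc_half : sqrtDisc (1 / 2) = ((Real.sqrt 3 / 2 : ℝ) : ℂ) := by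
  have h3 := ofReal_sqrt_three_sq
  refine cpow_half_eq ?_ ?_
  · rw [ofReal_re]
    positivity
  · push_cast
    linear_combination (1 / 4) * h3

theorem cosArg_zero_half : cosArg 0 (1 / 2) = 0 := by
  have : v 0 (1 / 2) = 0 := by
    rw [v]
    norm_num
  rw [cosArg, this]
  simp

theorem QPlus_half : QPlus (1 / 2) = ((-(Real.sqrt 3 / 36) : ℝ) : ℂ) := by
  have h3 := ofReal_sqrt_three_sq
  rw [QPlus_eq (1 / 2) (re_sqrtDisc_pos (by norm_num [pow_two])), cosArg_zero_half, sqrtDisc_half]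
  push_cast
  linear_combination (-(Real.sqrt 3 : ℂ) / 108) * h3

theorem eventually_rootsControlled : ∀ᶠ z : ℂ in 𝓝 (1 / 2), RootsControlled z := by
  have h0 : 0 < (((1 / 2 : ℂ)) ^ 2 - 1 / 2 + 1).re := by norm_num [pow_two]
  have hQ := (differentiableAt_QPlus h0).continuousAt
  have hA := (differentiableAt_cosArg h0).continuousAt
  have h3 : Real.sqrt 3 < 2 := by
    rw [Real.sqrt_lt' (by norm_num)]
    norm_num
  have e1 : ∀ᶠ z : ℂ in 𝓝 (1 / 2), 1 / 2 < (z ^ 2 - z + 1).re :=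
    ContinuousAt.eventually_lt continuousAt_const (by fun_prop) (by norm_num [pow_two])
  have e2 : ∀ᶠ z : ℂ in 𝓝 (1 / 2), ‖cosArg 0 z‖ < 1 / 2 :=
    ContinuousAt.eventually_lt hA.norm continuousAt_const (by rw [cosArg_zero_half]; norm_num)
  have e3 : ∀ᶠ z : ℂ in 𝓝 (1 / 2), ‖QPlus z‖ < 1 := by
    refine ContinuousAt.eventually_lt hQ.norm continuousAt_const ?_
    rw [QPlus_half, norm_real, norm_neg, Real.norm_of_nonneg (by positivity)]
    linarith
  have e4 : ∀ᶠ z : ℂ in 𝓝 (1 / 2), 0 < (-QPlus z).re := by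
    refine ContinuousAt.eventually_lt continuousAt_const
      (continuous_re.continuousAt.comp hQ.neg) ?_
    change 0 < (-QPlus (1 / 2)).re
    rw [QPlus_half, ← ofReal_neg, ofReal_re]
    simp
  filter_upwards [e1, e2, e3, e4] with z a b c d
  exact ⟨a, b, c, d⟩

namespace RootsControlled

variable {z : ℂ}

theorem re_disc_pos (h : RootsControlled z) : 0 < (z ^ 2 - z + 1).re :=
  lt_trans (by norm_num) h.re_disc

theorem re_sqrtDisc_pos (h : RootsControlled z) : 0 < (sqrtDisc z).re :=
  CoulombGas.re_sqrtDisc_pos h.re_disc_pos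

/-- A point strictly inside the segment from `cosArg 0 z` to `-1`, hence off the cuts of `arccos`.
-/
theorem abs_re_lt_one (h : RootsControlled z) {τ : ℝ} (h0 : 0 < τ) (h1 : τ < 1) :
    |(cosArg 0 z - τ * (1 + cosArg 0 z)).re| < 1 := by
  have hA := abs_lt.1 ((abs_re_le_norm _).trans_lt h.norm_cosArg)
  rw [sub_re, re_ofReal_mul, add_re, one_re, abs_lt]
  constructor <;> nlinarith [hA.1, hA.2]

/-- In `1 - B² = (1 - B)(1 + B)` the second factor is exactly `(1 - τ)(1 + cosArg 0 z)`, so the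
vanishing at `τ = 1` is of first order and the remaining factors are at least `1/2`. -/
theorem norm_one_sub_sq_ge (h : RootsControlled z) {τ : ℝ} (h0 : 0 < τ) (h1 : τ < 1) :
    (1 - τ) / 4 ≤ ‖1 - (cosArg 0 z - τ * (1 + cosArg 0 z)) ^ 2‖ := by
  have hA := h.norm_cosArg
  generalize cosArg 0 z = A at *
  have e : 1 - (A - τ * (1 + A)) ^ 2 =
      (((1 + τ : ℝ) : ℂ) - ((1 - τ : ℝ) : ℂ) * A) * (((1 - τ : ℝ) : ℂ) * (1 - -A)) := by
    push_cast
    ring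
  have n1 : 1 / 2 ≤ ‖((1 + τ : ℝ) : ℂ) - ((1 - τ : ℝ) : ℂ) * A‖ := by
    have := norm_sub_norm_le ((1 + τ : ℝ) : ℂ) (((1 - τ : ℝ) : ℂ) * A)
    rw [norm_mul, norm_real, norm_real, Real.norm_of_nonneg (by linarith),
      Real.norm_of_nonneg (by linarith)] at this
    nlinarith
  have n2 : 1 / 2 ≤ ‖1 - -A‖ := by
    have := norm_sub_norm_le (1 : ℂ) (-A)
    rw [norm_one, norm_neg] at this
    linarith
  have h1' : 0 < 1 - τ := by linarith
  rw [e, norm_mul, norm_mul, norm_real, Real.norm_of_nonneg h1'.le]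
  calc (1 - τ) / 4 = 1 / 2 * ((1 - τ) * (1 / 2)) := by ring
    _ ≤ _ := by gcongr

theorem norm_le_one (h : RootsControlled z) {τ : ℝ} (h0 : 0 < τ) (h1 : τ < 1) :
    ‖cosArg 0 z - τ * (1 + cosArg 0 z)‖ ≤ 1 := by
  have hA := h.norm_cosArg
  generalize cosArg 0 z = A at *
  have e : A - τ * (1 + A) = ((1 - τ : ℝ) : ℂ) * A - (τ : ℂ) := by
    push_cast
    ring
  rw [e]
  refine (norm_sub_le _ _).trans ?_
  rw [norm_mul, norm_real, norm_real, Real.norm_of_nonneg h0.le, Real.norm_of_nonneg (by linarith)]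
  nlinarith [norm_nonneg A]

end RootsControlled

/-- For `|x| > 1` the triangle inequality gives `4|x|³ - 3|x| > 1`. This bounds the cosine in the
germ from its triple angle alone, without estimating `arccos`. -/
theorem norm_le_one_of_chebyshev {x : ℂ} (h : ‖4 * x ^ 3 - 3 * x‖ ≤ 1) : ‖x‖ ≤ 1 := by
  by_contra! hx
  have := norm_sub_norm_le (4 * x ^ 3) (3 * x)
  rw [norm_mul, norm_mul, norm_pow] at this
  norm_num at this
  nlinarith [mul_pos (sub_pos.2 hx) (sub_pos.2 hx),
    mul_pos (sub_pos.2 hx) (one_pos.trans hx)]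

/-- The Borel germ as an explicit function of `τ = e^{-ζ}`. -/
noncomputable def germ (τ z : ℂ) : ℂ :=
  QPlus z * τ * ((2 * (sqrtDisc z / 3) *
    (-3 * Complex.cos (arccos (cosArg 0 z - τ * (1 + cosArg 0 z)) / 3 + 2 * Real.pi / 3))) /
    ((2 * (sqrtDisc z / 3)) ^ 3 * (3 * Real.sqrt 3 / 4) *
      (1 - (cosArg 0 z - τ * (1 + cosArg 0 z)) ^ 2) ^ (1 / 2 : ℂ)))

theorem phi_eq_germ {z : ℂ} (hz : 0 < (sqrtDisc z).re) (ζ : ℂ) :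
    phi z ζ = germ (exp (-ζ)) z := by
  rw [phi, Phi, w1_add_w2_sub_two_mul_w0 hz, sub_mul_sub_mul_sub_eq hz, angle_eq,
    cosArg_QPlus_mul z _ hz, germ]

/-- The factor `τ` supplies an extra `e^{-ζ}`, which moves the abscissa of convergence to `Re C >
-1`; the square root of the discriminant gives the integrable singularity at `τ = 1`. -/
theorem norm_germ_le {z : ℂ} (h : RootsControlled z) {τ : ℝ} (h0 : 0 < τ) (h1 : τ < 1) :
    ‖germ τ z‖ ≤ 27 * τ / Real.sqrt (1 - τ) := by
  have hA1 := h.norm_le_one h0 h1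
  have hA2 := h.norm_one_sub_sq_ge h0 h1
  have hs := sqrtDisc_sq z
  have hd : 1 / 2 ≤ ‖sqrtDisc z‖ ^ 2 := by
    rw [← norm_pow, hs]
    exact h.re_disc.le.trans (re_le_norm _)
  have hsn : 0 < ‖sqrtDisc z‖ := by
    refine norm_pos_iff.2 fun h0 => ?_
    have := h.re_sqrtDisc_pos
    simp [h0] at this
  have hq := h.norm_QPlus
  unfold germ
  generalize cosArg 0 z - τ * (1 + cosArg 0 z) = A at *
  have hy := congrArg norm (cpow_half_sq (1 - A ^ 2))
  rw [norm_pow] at hy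
  have hX : ‖Complex.cos (arccos A / 3 + 2 * Real.pi / 3)‖ ≤ 1 := by
    refine norm_le_one_of_chebyshev ?_
    rw [← Complex.cos_three_mul, show 3 * (arccos A / 3 + 2 * Real.pi / 3) =
      arccos A + 2 * Real.pi by ring, Complex.cos_add_two_pi, cos_arccos]
    exact hA1
  generalize Complex.cos (arccos A / 3 + 2 * Real.pi / 3) = X at *
  generalize (1 - A ^ 2) ^ (1 / 2 : ℂ) = y at *
  have h1' : 0 < 1 - τ := by linarith
  have hyb : Real.sqrt (1 - τ) / 2 ≤ ‖y‖ := by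
    refine abs_le_of_sq_le_sq' ?_ (norm_nonneg y) |>.2
    rw [hy, div_pow, Real.sq_sqrt h1'.le]
    linarith
  have hr : 0 < Real.sqrt (1 - τ) := Real.sqrt_pos.2 h1'
  have h3 : 4 / 3 ≤ Real.sqrt 3 := Real.le_sqrt_of_sq_le (by norm_num)
  have hyp : 0 < ‖y‖ := by linarith
  simp only [norm_mul, norm_div, norm_pow, norm_neg, norm_real, norm_ofNat, Real.norm_eq_abs,
    abs_of_pos h0, abs_of_nonneg (Real.sqrt_nonneg 3)]
  rw [← mul_div_assoc, div_le_div_iff₀ (by positivity) hr]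
  generalize ‖sqrtDisc z‖ = s at *
  generalize Real.sqrt (1 - τ) = r at *
  generalize Real.sqrt 3 = t at *
  -- The constant `27` absorbs the factor `(2/3)³` of the denominator, using `|Q₊| < 1`, `|X| ≤ 1`
  -- and `r ≤ 2|y|` above, `s² ≥ 1/2` and `√3 ≥ 4/3` below.
  calc ‖QPlus z‖ * τ * (2 * (s / 3) * (3 * ‖X‖)) * r
      ≤ 1 * τ * (2 * (s / 3) * (3 * 1)) * (2 * ‖y‖) := by
        gcongr
        linarith
    _ = τ * s * ‖y‖ * 4 := by ring
    _ ≤ τ * s * ‖y‖ * (27 * ((8 / 27) * (1 / 2) * (3 * (4 / 3) / 4))) := by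
        gcongr
        norm_num
    _ ≤ τ * s * ‖y‖ * (27 * ((8 / 27) * s ^ 2 * (3 * t / 4))) := by gcongr
    _ = _ := by ring

theorem differentiableAt_germ {z : ℂ} (h : RootsControlled z) {τ : ℝ} (h0 : 0 < τ) (h1 : τ < 1) :
    DifferentiableAt ℂ (germ τ) z := by
  have hs := differentiableAt_sqrtDisc h.re_disc_pos
  have hq := differentiableAt_QPlus h.re_disc_pos
  have hA := differentiableAt_cosArg h.re_disc_pos
  have hre := h.abs_re_lt_one h0 h1
  have hne : sqrtDisc z ≠ 0 := by
    intro h0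
    have := h.re_sqrtDisc_pos
    simp [h0] at this
  have hB : DifferentiableAt ℂ (fun z => cosArg 0 z - τ * (1 + cosArg 0 z)) z := by fun_prop
  have hac : DifferentiableAt ℂ (fun z => arccos (cosArg 0 z - τ * (1 + cosArg 0 z))) z :=
    DifferentiableAt.comp z (g := arccos) (differentiableAt_arccos hre) hB
  have hy : DifferentiableAt ℂ
      (fun z => (1 - (cosArg 0 z - τ * (1 + cosArg 0 z)) ^ 2) ^ (1 / 2 : ℂ)) z :=
    DifferentiableAt.cpow_const (by fun_prop) (one_sub_sq_mem_slitPlane hre)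
  have hyp := re_cpow_half_pos (one_sub_sq_mem_slitPlane hre)
  unfold germ
  refine (hq.mul_const _).mul (DifferentiableAt.div ?_ ?_ ?_)
  · exact (by fun_prop : DifferentiableAt ℂ (fun z => 2 * (sqrtDisc z / 3)) z).mul
      (((hac.div_const 3).add_const (2 * Real.pi / 3 : ℂ)).ccos.const_mul (-3))
  · exact ((by fun_prop : DifferentiableAt ℂ (fun z => (2 * (sqrtDisc z / 3)) ^ 3) z).mul_const _).mul
      hy
  · have h3 : (Real.sqrt 3 : ℂ) ≠ 0 := by
      rw [ofReal_ne_zero]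
      positivity
    have hy0 : (1 - (cosArg 0 z - τ * (1 + cosArg 0 z)) ^ 2) ^ (1 / 2 : ℂ) ≠ 0 := by
      intro h0
      rw [h0, zero_re] at hyp
      exact lt_irrefl _ hyp
    refine mul_ne_zero (mul_ne_zero ?_ ?_) hy0
    · simp [hne]
    · simp [h3]

/-! ### Convergence of the Laplace integral and holomorphy in `z` -/

theorem laplaceIntegrand_zero (f : ℂ → ℂ) (C : ℂ) (t : ℝ) :
    laplaceIntegrand 0 f C t = exp (-C * t) * f t := by
  simp [laplaceIntegrand]

theorem measurable_laplaceIntegrand (C z : ℂ) : Measurable (laplaceIntegrand 0 (phi z) C) := by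
  have : laplaceIntegrand 0 (phi z) C = fun t : ℝ => exp (-C * t) * phi z t :=
    funext fun t => laplaceIntegrand_zero _ _ _
  rw [this]
  unfold phi Phi w0 w1 w2 angle arccos v
  fun_prop

/-- The dominating function of the Laplace integral. -/
noncomputable def laplaceBound (b t : ℝ) : ℝ :=
  t ^ (-1 / 2 : ℝ) * Real.exp (-b * t ^ (1 : ℝ)) + t ^ (1 / 2 : ℝ) * Real.exp (-b * t ^ (1 : ℝ))

theorem integrableOn_laplaceBound {b : ℝ} (hb : 0 < b) : IntegrableOn (laplaceBound b) (Ioi 0) :=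
  (integrableOn_rpow_mul_exp_neg_mul_rpow (by norm_num) one_pos hb).add
    (integrableOn_rpow_mul_exp_neg_mul_rpow (by norm_num) one_pos hb)

/-- From `1 - e^{-t} ≥ t / (1 + t) ≥ t / (1 + t)²` the inverse square root is at most `(1 + t) / √t
= t^(-1/2) + t^(1/2)`. -/
theorem exp_div_sqrt_le_laplaceBound (b : ℝ) {t : ℝ} (ht : 0 < t) :
    Real.exp (-b * t) / Real.sqrt (1 - Real.exp (-t)) ≤ laplaceBound b t := by
  have h1 : Real.sqrt t / (1 + t) ≤ Real.sqrt (1 - Real.exp (-t)) := by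
    refine Real.le_sqrt_of_sq_le ?_
    rw [div_pow, Real.sq_sqrt ht.le]
    have h2 : Real.exp (-t) ≤ 1 / (1 + t) := by
      rw [Real.exp_neg, ← one_div]
      refine one_div_le_one_div_of_le (by linarith) ?_
      linarith [Real.add_one_le_exp t]
    have h3 : t / (1 + t) ^ 2 ≤ 1 - 1 / (1 + t) := by
      have h4 : 1 - 1 / (1 + t) = t / (1 + t) := by field_simp; ring
      rw [h4]
      refine div_le_div_of_nonneg_left ht.le (by linarith) ?_
      nlinarith
    linarith
  have hst : 0 < Real.sqrt t := Real.sqrt_pos.2 ht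
  have e : laplaceBound b t = Real.exp (-b * t) / (Real.sqrt t / (1 + t)) := by
    have h5 : t ^ (-1 / 2 : ℝ) = (Real.sqrt t)⁻¹ := by
      rw [Real.sqrt_eq_rpow, ← Real.rpow_neg ht.le]
      norm_num
    rw [laplaceBound, Real.rpow_one, h5, ← Real.sqrt_eq_rpow]
    have h6 := Real.sq_sqrt ht.le
    field_simp
    rw [h6]
  rw [e]
  gcongr

theorem norm_laplaceIntegrand_le {z : ℂ} (h : RootsControlled z) (C : ℂ) {t : ℝ} (ht : 0 < t) :
    ‖laplaceIntegrand 0 (phi z) C t‖ ≤ 27 * laplaceBound (C.re + 1) t := by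
  have h1 : Real.exp (-t) < 1 := Real.exp_lt_one_iff.2 (by linarith)
  have hg := norm_germ_le h (Real.exp_pos (-t)) h1
  rw [laplaceIntegrand_zero, phi_eq_germ h.re_sqrtDisc_pos, norm_mul, norm_exp]
  rw [ofReal_exp, ofReal_neg] at hg
  have e : (-C * (t : ℂ)).re = -C.re * t := by simp
  rw [e]
  calc Real.exp (-C.re * t) * ‖germ (exp (-(t : ℂ))) z‖
      ≤ Real.exp (-C.re * t) * (27 * Real.exp (-t) / Real.sqrt (1 - Real.exp (-t))) := by gcongr
    _ = 27 * (Real.exp (-(C.re + 1) * t) / Real.sqrt (1 - Real.exp (-t))) := by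
        rw [show -(C.re + 1) * t = -C.re * t + -t by ring, Real.exp_add]
        ring
    _ ≤ _ := by
        gcongr
        exact exp_div_sqrt_le_laplaceBound _ ht

theorem integrableOn_laplaceIntegrand {z : ℂ} (h : RootsControlled z) {C : ℂ} (hC : -1 < C.re) :
    IntegrableOn (laplaceIntegrand 0 (phi z) C) (Ioi 0) := by
  refine Integrable.mono' ((integrableOn_laplaceBound (b := C.re + 1) (by linarith)).const_mul 27)
    (measurable_laplaceIntegrand C z).aestronglyMeasurable ?_
  exact (ae_restrict_iff' measurableSet_Ioi).2
    (.of_forall fun t ht => norm_laplaceIntegrand_le h C ht)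

theorem differentiableOn_laplace {U : Set ℂ} (hU : ∀ z ∈ U, RootsControlled z) (hUo : IsOpen U)
    {C : ℂ} (hC : -1 < C.re) : DifferentiableOn ℂ (fun z => laplace 0 (phi z) C) U := by
  intro z hz
  obtain ⟨r, hr, hrU⟩ := Metric.isOpen_iff.1 hUo z hz
  refine (differentiableAt_integral_of_dominated (F := fun z t => laplaceIntegrand 0 (phi z) C t)
    hr ?_ ?_ ?_ ((integrableOn_laplaceBound (b := C.re + 1) (by linarith)).const_mul
      27)).differentiableWithinAt
  · exact fun w _ => (measurable_laplaceIntegrand C w).aestronglyMeasurable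
  · refine (ae_restrict_iff' measurableSet_Ioi).2 (.of_forall fun t ht => ?_)
    have h1 : Real.exp (-t) < 1 := Real.exp_lt_one_iff.2 (neg_lt_zero.2 ht)
    have hd : DifferentiableOn ℂ (fun w => exp (-C * t) * germ (Real.exp (-t) : ℝ) w) (ball z r) :=
      fun w hw => ((differentiableAt_germ (hU w (hrU hw)) (Real.exp_pos _)
        h1).const_mul _).differentiableWithinAt
    refine hd.congr fun w hw => ?_
    simp only [laplaceIntegrand_zero]
    rw [phi_eq_germ (hU w (hrU hw)).re_sqrtDisc_pos, ofReal_exp, ofReal_neg]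
  · exact (ae_restrict_iff' measurableSet_Ioi).2
      (.of_forall fun t ht w hw => norm_laplaceIntegrand_le (hU w (hrU hw)) C ht)

theorem differentiableOn_QPlusPow {U : Set ℂ} (hU : ∀ z ∈ U, RootsControlled z) (C : ℂ) :
    DifferentiableOn ℂ (fun z => QPlusPow C z) U := by
  intro z hz
  have h := (differentiableAt_QPlus (hU z hz).re_disc_pos).neg.clog (Or.inl (hU z hz).re_neg_QPlus)
  exact ((h.const_add (Real.pi * I)).const_mul C).cexp.differentiableWithinAt

/-! ### Real `z`: branches of the inverse and the substitution `Q(w) = Q₊ e^{-ζ}` -/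

theorem cosArg_Q (z x : ℂ) (hz : 0 < (sqrtDisc z).re) :
    cosArg (Q z ((z + 1) / 3 + 2 * (sqrtDisc z / 3) * x)) z = 4 * x ^ 3 - 3 * x := by
  have hne : sqrtDisc z ≠ 0 := by
    intro h
    simp [h] at hz
  have hk : 2 * sqrtDisc z ^ 3 / 27 ≠ 0 := by simp [hne]
  have h := cosArg_eq_add (Q z ((z + 1) / 3 + 2 * (sqrtDisc z / 3) * x)) z hz
  have h2 := Q_chebyshev z x hz
  refine mul_left_cancel₀ hk ?_
  linear_combination h + h2

/-- For such `t` the angle `3t` lies in `(0, π)`, so `arccos (cos 3t) / 3` returns `t` itself. -/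
theorem w1_Q_cos (z : ℂ) (hz : 0 < (sqrtDisc z).re) {t : ℝ} (h0 : 0 < t) (h1 : t < Real.pi / 3) :
    w1 (Q z ((z + 1) / 3 + 2 * (sqrtDisc z / 3) * Real.cos t)) z =
      (z + 1) / 3 + 2 * (sqrtDisc z / 3) * Real.cos t := by
  have h3 : (4 * (Real.cos t : ℂ) ^ 3 - 3 * Real.cos t) = (Real.cos (3 * t) : ℂ) := by
    rw [Real.cos_three_mul]
    push_cast
    rfl
  rw [w1, cpow_neg_u_div z hz, angle_eq, cosArg_Q z _ hz, h3,
    arccos_cos (by linarith) (by linarith), ofReal_cos]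
  congr 3
  push_cast
  ring

/-- Here it is `2π - 3t` that lies in `(0, π)`. A third of it, shifted by `-2π/3`, is `-t`, and the
cosine is even. -/
theorem w2_Q_cos (z : ℂ) (hz : 0 < (sqrtDisc z).re) {t : ℝ} (h0 : Real.pi / 3 < t)
    (h1 : t < 2 * Real.pi / 3) :
    w2 (Q z ((z + 1) / 3 + 2 * (sqrtDisc z / 3) * Real.cos t)) z =
      (z + 1) / 3 + 2 * (sqrtDisc z / 3) * Real.cos t := by
  have h3 : (4 * (Real.cos t : ℂ) ^ 3 - 3 * Real.cos t) =
      (Real.cos (2 * Real.pi - 3 * t) : ℂ) := by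
    rw [Real.cos_two_pi_sub, Real.cos_three_mul]
    push_cast
    rfl
  rw [w2, cpow_neg_u_div z hz, angle_eq, cosArg_Q z _ hz, h3,
    arccos_cos (by linarith) (by linarith), ofReal_cos, ← Complex.cos_neg (t : ℂ)]
  congr 2
  push_cast
  ring_nf

/-- The cubic on the real axis. -/
def realCubic (z w : ℝ) : ℝ := w * (w - 1) * (w - z)

theorem Q_ofReal (z w : ℝ) : Q z w = (realCubic z w : ℂ) := by
  rw [Q, realCubic]
  push_cast
  rfl

theorem hasDerivAt_realCubic (z w : ℝ) :
    HasDerivAt (realCubic z) (3 * w ^ 2 - 2 * (z + 1) * w + z) w := by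
  have h := ((hasDerivAt_id w).mul ((hasDerivAt_id w).sub_const 1)).mul
    ((hasDerivAt_id w).sub_const z)
  convert! h using 1
  simp
  ring

/-- The positive square root of the discriminant of the derivative of the real cubic. -/
noncomputable def realSqrtDisc (z : ℝ) : ℝ := Real.sqrt (z ^ 2 - z + 1)

/-- The critical point of the real cubic in `(z, 1)`. -/
noncomputable def critPt (z : ℝ) : ℝ := (z + 1) / 3 + realSqrtDisc z / 3

section RealPoints

variable {z : ℝ}

theorem realSqrtDisc_sq (z : ℝ) : realSqrtDisc z ^ 2 = z ^ 2 - z + 1 :=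
  Real.sq_sqrt (by nlinarith [sq_nonneg (z - 1 / 2)])

theorem realSqrtDisc_pos (z : ℝ) : 0 < realSqrtDisc z :=
  Real.sqrt_pos.2 (by nlinarith [sq_nonneg (z - 1 / 2)])

theorem sqrtDisc_ofReal (z : ℝ) : sqrtDisc z = realSqrtDisc z := by
  refine cpow_half_eq ?_ ?_
  · rw [ofReal_re]
    exact realSqrtDisc_pos z
  · exact_mod_cast realSqrtDisc_sq z

theorem wPlus_ofReal (z : ℝ) : wPlus z = critPt z := by
  rw [wPlus_eq, sqrtDisc_ofReal, critPt]
  push_cast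
  rfl

theorem QPlus_ofReal (z : ℝ) : QPlus z = (realCubic z (critPt z) : ℂ) := by
  rw [QPlus, wPlus_ofReal, Q_ofReal]

theorem critPt_lt_one (hz1 : z < 1) : critPt z < 1 := by
  have := realSqrtDisc_sq z
  have h : realSqrtDisc z < 2 - z := by
    refine lt_of_pow_lt_pow_left₀ 2 (by linarith) ?_
    nlinarith
  rw [critPt]
  linarith

theorem lt_critPt (hz0 : 0 < z) (hz1 : z < 1) : z < critPt z := by
  have := realSqrtDisc_sq z
  have h : 2 * z - 1 < realSqrtDisc z := by
    refine lt_of_pow_lt_pow_left₀ 2 (realSqrtDisc_pos z).le ?_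
    nlinarith
  rw [critPt]
  linarith

/-- Says that `z` lies to the right of the smaller critical point `(z + 1 - r) / 3`, with `r` the
root of the discriminant. -/
theorem one_sub_two_mul_lt (hz0 : 0 < z) (hz1 : z < 1) : 1 - 2 * z < realSqrtDisc z := by
  have := realSqrtDisc_sq z
  refine lt_of_pow_lt_pow_left₀ 2 (realSqrtDisc_pos z).le ?_
  nlinarith

/-- Says that `1` lies below `(z + 1 + 2r) / 3`, so that `(z, 1)` stays in the range of the cosine
parametrization. -/
theorem two_sub_lt (hz0 : 0 < z) : 2 - z < 2 * realSqrtDisc z := by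
  have := realSqrtDisc_sq z
  have := realSqrtDisc_pos z
  refine lt_of_pow_lt_pow_left₀ 2 (by linarith) ?_
  nlinarith

theorem realCubic_neg (hz0 : 0 < z) {w : ℝ} (hw : w ∈ Ioo z 1) : realCubic z w < 0 := by
  have h0 : 0 < w := hz0.trans hw.1
  rw [realCubic]
  exact mul_neg_of_neg_of_pos (mul_neg_of_pos_of_neg h0 (by linarith [hw.2])) (by linarith [hw.1])

/-- The difference of the two values has a double zero at the critical point, and its third zero `(z
+ 1 - 2r) / 3` lies to the left of `z`. -/
theorem realCubic_critPt_lt (hz0 : 0 < z) (hz1 : z < 1) {w : ℝ} (hw : z < w) (hwp : w ≠ critPt z) :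
    realCubic z (critPt z) < realCubic z w := by
  have h2 := realSqrtDisc_sq z
  have h3 := one_sub_two_mul_lt hz0 hz1
  have h4 := realSqrtDisc_pos z
  have e : realCubic z w - realCubic z (critPt z) =
      (w - critPt z) ^ 2 * (w - ((z + 1) / 3 - 2 * realSqrtDisc z / 3)) := by
    rw [realCubic, realCubic, critPt]
    generalize realSqrtDisc z = r at *
    linear_combination (w / 3 - (z + 1) / 9 - r / 9) * h2
  have h5 : 0 < (w - critPt z) ^ 2 := by
    have := sub_ne_zero.2 hwp
    positivity
  have h6 : 0 < (w - critPt z) ^ 2 * (w - ((z + 1) / 3 - 2 * realSqrtDisc z / 3)) :=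
    mul_pos h5 (by linarith)
  linarith

theorem deriv_realCubic_eq (z w : ℝ) : 3 * w ^ 2 - 2 * (z + 1) * w + z =
    3 * (w - critPt z) * (w - ((z + 1) / 3 - realSqrtDisc z / 3)) := by
  have h2 := realSqrtDisc_sq z
  rw [critPt]
  linear_combination (1 / 3) * h2

theorem exists_cos_eq {w : ℝ} (h1 : (z + 1) / 3 - 2 * realSqrtDisc z / 3 ≤ w)
    (h2 : w ≤ (z + 1) / 3 + 2 * realSqrtDisc z / 3) :
    w = (z + 1) / 3 + 2 * (realSqrtDisc z / 3) *
      Real.cos (Real.arccos ((w - (z + 1) / 3) / (2 * realSqrtDisc z / 3))) := by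
  have h4 := realSqrtDisc_pos z
  rw [Real.cos_arccos]
  · field_simp
    ring
  · rw [le_div_iff₀ (by positivity)]
    linarith
  · rw [div_le_iff₀ (by positivity)]
    linarith

theorem w1_Q_ofReal (hz0 : 0 < z) {w : ℝ} (hw : w ∈ Ioo (critPt z) 1) : w1 (Q z w) z = w := by
  have h4 := realSqrtDisc_pos z
  have h5 := two_sub_lt hz0
  have hw1 := hw.1
  have hw2 := hw.2
  rw [critPt] at hw1
  have e := exists_cos_eq (z := z) (w := w) (by linarith) (by linarith)
  have hc1 : Real.arccos ((w - (z + 1) / 3) / (2 * realSqrtDisc z / 3)) < Real.pi / 3 := by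
    have h6 : (1 / 2 : ℝ) < (w - (z + 1) / 3) / (2 * realSqrtDisc z / 3) := by
      rw [lt_div_iff₀ (by positivity)]
      linarith
    rw [← Real.arccos_cos (x := Real.pi / 3) (by positivity) (by linarith [Real.pi_pos]),
      Real.cos_pi_div_three]
    refine Real.strictAntiOn_arccos ⟨by norm_num, by norm_num⟩ ⟨by linarith, ?_⟩ h6
    rw [div_le_one (by positivity)]
    linarith
  have hc0 : 0 < Real.arccos ((w - (z + 1) / 3) / (2 * realSqrtDisc z / 3)) := by
    rw [Real.arccos_pos, div_lt_one (by positivity)]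
    linarith
  have h := w1_Q_cos z (by rw [sqrtDisc_ofReal, ofReal_re]; exact h4) hc0 hc1
  have e' : (w : ℂ) = (z + 1) / 3 + 2 * (sqrtDisc z / 3) *
      Real.cos (Real.arccos ((w - (z + 1) / 3) / (2 * realSqrtDisc z / 3))) := by
    rw [sqrtDisc_ofReal]
    exact_mod_cast e
  rwa [← e'] at h

theorem w2_Q_ofReal (hz0 : 0 < z) (hz1 : z < 1) {w : ℝ} (hw : w ∈ Ioo z (critPt z)) :
    w2 (Q z w) z = w := by
  have h4 := realSqrtDisc_pos z
  have h5 := one_sub_two_mul_lt hz0 hz1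
  have hw1 := hw.1
  have hw2 := hw.2
  rw [critPt] at hw2
  have e := exists_cos_eq (z := z) (w := w) (by linarith) (by linarith)
  have h6 : (w - (z + 1) / 3) / (2 * realSqrtDisc z / 3) < 1 / 2 := by
    rw [div_lt_iff₀ (by positivity)]
    linarith
  have h7 : -(1 / 2) < (w - (z + 1) / 3) / (2 * realSqrtDisc z / 3) := by
    rw [lt_div_iff₀ (by positivity)]
    linarith
  have hc0 : Real.pi / 3 < Real.arccos ((w - (z + 1) / 3) / (2 * realSqrtDisc z / 3)) := by
    rw [← Real.arccos_cos (x := Real.pi / 3) (by positivity) (by linarith [Real.pi_pos]),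
      Real.cos_pi_div_three]
    exact Real.strictAntiOn_arccos ⟨by linarith, by linarith⟩ ⟨by norm_num, by norm_num⟩ h6
  have hc1 : Real.arccos ((w - (z + 1) / 3) / (2 * realSqrtDisc z / 3)) < 2 * Real.pi / 3 := by
    rw [← Real.arccos_cos (x := 2 * Real.pi / 3) (by positivity) (by linarith [Real.pi_pos]),
      show 2 * Real.pi / 3 = Real.pi - Real.pi / 3 by ring, Real.cos_pi_sub,
      Real.cos_pi_div_three]
    exact Real.strictAntiOn_arccos ⟨by norm_num, by norm_num⟩ ⟨by linarith, by linarith⟩ h7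
  have h := w2_Q_cos z (by rw [sqrtDisc_ofReal, ofReal_re]; exact h4) hc0 hc1
  have e' : (w : ℂ) = (z + 1) / 3 + 2 * (sqrtDisc z / 3) *
      Real.cos (Real.arccos ((w - (z + 1) / 3) / (2 * realSqrtDisc z / 3))) := by
    rw [sqrtDisc_ofReal]
    exact_mod_cast e
  rwa [← e'] at h

theorem absCubicPow_of_mem (hz0 : 0 < z) {w : ℝ} (hw : w ∈ Ioo z 1) (C : ℂ) :
    absCubicPow C z w = ((-realCubic z w : ℝ) : ℂ) ^ C := by
  rw [absCubicPow, realCubic, abs_of_pos (hz0.trans hw.1), abs_of_neg (sub_neg.2 hw.2),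
    abs_of_pos (sub_pos.2 hw.1)]
  congr 2
  ring

/-- Affine change of variable to the parametrization of `I3`, where the integrand is comparable to
`(t (1 - t))^C`. -/
theorem integrableOn_absCubicPow (hz : NearHalf z) (hz0 : 0 < z) (hz1 : z < 1) {C : ℂ}
    (hC : -1 < C.re) : IntegrableOn (absCubicPow C z) (Ioo z 1) := by
  have h1 : 0 < 1 - z := sub_pos.2 hz1
  have himg : Ioo z 1 = (fun t : ℝ => z + t * (1 - z)) '' Ioo 0 1 := by
    ext w
    constructor
    · intro hw
      refine ⟨(w - z) / (1 - z), ⟨div_pos (sub_pos.2 hw.1) h1, ?_⟩, ?_⟩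
      · rw [div_lt_one h1]
        linarith [hw.2]
      · simp only
        rw [div_mul_cancel₀ _ h1.ne']
        ring
    · rintro ⟨t, ht, rfl⟩
      constructor <;> simp only <;> nlinarith [ht.1, ht.2]
  rw [himg, integrableOn_image_iff_integrableOn_abs_deriv_smul (f' := fun _ => 1 - z)
    measurableSet_Ioo]
  · have h := (comparable_I3 (U := {(z : ℂ)}) (by simpa)).integrableOn (C := C) rfl
      (integrableOn_mul_one_sub_rpow hC)
    refine IntegrableOn.congr_fun (h.smul |1 - z|) (fun t ht => ?_) measurableSet_Ioo
    have hm : z + t * (1 - z) ∈ Ioo z 1 := by rw [himg]; exact mem_image_of_mem _ ht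
    simp only [Pi.smul_apply]
    rw [absCubicPow_of_mem hz0 hm, ofReal_neg, ← Q_ofReal]
    push_cast
    rfl
  · intro t _
    simpa using (((hasDerivAt_id t).mul_const (1 - z)).const_add z).hasDerivWithinAt
  · intro t _ t' _ h
    simpa [h1.ne'] using h

/-- Change of variable from a branch of the inverse of the cubic to its values. -/
theorem integral_branch (hz0 : 0 < z) (hz1 : z < 1) {C : ℂ} {S : Set ℝ} (hS : MeasurableSet S)
    (hSz : S ⊆ Ioo z 1) (hSp : ∀ w ∈ S, w ≠ critPt z) {ε : ℝ} (hε : ε ^ 2 = 1)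
    (hsgn : ∀ w ∈ S, 0 < ε * (3 * w ^ 2 - 2 * (z + 1) * w + z))
    (hsurj : Ioo (realCubic z (critPt z)) 0 ⊆ realCubic z '' S)
    {ω : ℂ → ℂ} (hω : ∀ w ∈ S, ω (Q z w) = w) (hint : IntegrableOn (absCubicPow C z) S) :
    IntegrableOn (fun t : ℝ => exp (-C * t) *
      (QPlus z * exp (-(t : ℂ)) / Q' z (ω (QPlus z * exp (-(t : ℂ)))))) (Ioi 0) ∧
    exp (C * Complex.log (-QPlus z)) * (∫ t in Ioi (0 : ℝ), exp (-C * t) *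
      (QPlus z * exp (-(t : ℂ)) / Q' z (ω (QPlus z * exp (-(t : ℂ)))))) =
      -ε * ∫ w in S, absCubicPow C z w := by
  set g : ℝ → ℂ := fun t : ℝ => exp (-C * t) *
      (QPlus z * exp (-(t : ℂ)) / Q' z (ω (QPlus z * exp (-(t : ℂ))))) with hg
  -- `T w` is the value of `ζ` for which `Q₊ e^{-ζ} = Q(w)`.
  set T : ℝ → ℝ := fun w => Real.log (-realCubic z (critPt z)) - Real.log (-realCubic z w) with hT
  have hpneg : realCubic z (critPt z) < 0 :=
    realCubic_neg hz0 ⟨lt_critPt hz0 hz1, critPt_lt_one hz1⟩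
  have hneg : ∀ w ∈ S, realCubic z w < 0 := fun w hw => realCubic_neg hz0 (hSz hw)
  have hexp : ∀ w ∈ S, QPlus z * exp (-(T w : ℂ)) = Q z w := by
    intro w hw
    rw [QPlus_ofReal, Q_ofReal, ← ofReal_neg, ← ofReal_exp, ← ofReal_mul, hT]
    simp only [neg_sub]
    rw [Real.exp_sub, Real.exp_log (neg_pos.2 (hneg w hw)), Real.exp_log (neg_pos.2 hpneg)]
    congr 1
    have := hpneg.ne
    field_simp
  have hderiv : ∀ w ∈ S, HasDerivWithinAt T
      (-((3 * w ^ 2 - 2 * (z + 1) * w + z) / realCubic z w)) S w := by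
    intro w hw
    have h := (((hasDerivAt_realCubic z w).neg).log (neg_ne_zero.2 (hneg w hw).ne)).const_sub
      (Real.log (-realCubic z (critPt z)))
    refine h.hasDerivWithinAt.congr_deriv ?_
    rw [Pi.neg_apply, neg_div_neg_eq]
  -- `T w` determines `Q(w)`, from which the branch `ω` recovers `w`.
  have hinj : InjOn T S := by
    intro w hw w' hw' h
    have h1 := hexp w hw
    rw [h, hexp w' hw'] at h1
    have := hω w hw
    rw [← h1, hω w' hw'] at this
    exact_mod_cast this.symm
  have himg : T '' S = Ioi 0 := by
    ext t
    constructor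
    · rintro ⟨w, hw, rfl⟩
      have h1 := realCubic_critPt_lt hz0 hz1 (hSz hw).1 (hSp w hw)
      have := Real.log_lt_log (neg_pos.2 (hneg w hw)) (neg_lt_neg h1)
      exact sub_pos.2 this
    · intro ht
      have ht1 : Real.exp (-t) < 1 := Real.exp_lt_one_iff.2 (neg_lt_zero.2 ht)
      have ht0 := Real.exp_pos (-t)
      obtain ⟨w, hw, hwt⟩ := hsurj (a := realCubic z (critPt z) * Real.exp (-t))
        ⟨by nlinarith, by nlinarith⟩
      refine ⟨w, hw, ?_⟩
      simp only [hT]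
      rw [hwt, ← neg_mul, Real.log_mul (neg_pos.2 hpneg).ne' ht0.ne', Real.log_exp]
      ring
  -- The Jacobian `|Q' / Q|` cancels the weight `q / Q'` up to the sign `-ε`, because `Q < 0` and
  -- `ε` is the sign of `Q'` on `S`; only `(-Q)^C` remains.
  have hcomp : ∀ w ∈ S, |-((3 * w ^ 2 - 2 * (z + 1) * w + z) / realCubic z w)| • g (T w) =
      (-ε * exp (-(C * Complex.log (-QPlus z)))) * absCubicPow C z w := by
    intro w hw
    have hs := hsgn w hw
    have hn := hneg w hw
    have hne : (3 * w ^ 2 - 2 * (z + 1) * w + z) ≠ 0 := right_ne_zero_of_mul hs.ne'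
    have habs : |-((3 * w ^ 2 - 2 * (z + 1) * w + z) / realCubic z w)| =
        -(ε * ((3 * w ^ 2 - 2 * (z + 1) * w + z) / realCubic z w)) := by
      have h1 : |ε| = 1 := by
        rcases eq_or_eq_neg_of_sq_eq_sq ε 1 (by rw [hε]; norm_num) with h | h <;> simp [h]
      calc |-((3 * w ^ 2 - 2 * (z + 1) * w + z) / realCubic z w)|
          = |ε| * |(3 * w ^ 2 - 2 * (z + 1) * w + z) / realCubic z w| := by
            rw [h1, abs_neg, one_mul]
        _ = |ε * ((3 * w ^ 2 - 2 * (z + 1) * w + z) / realCubic z w)| := (abs_mul _ _).symm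
        _ = _ := by
            refine abs_of_neg ?_
            rw [← mul_div_assoc]
            exact div_neg_of_pos_of_neg hs hn
    have hQ' : Q' z w = ((3 * w ^ 2 - 2 * (z + 1) * w + z : ℝ) : ℂ) := by
      rw [Q']
      push_cast
      rfl
    have hpow : absCubicPow C z w = exp (C * Complex.log (-QPlus z)) * exp (-C * T w) := by
      have hn0 : ((-realCubic z w : ℝ) : ℂ) ≠ 0 := ofReal_ne_zero.2 (neg_ne_zero.2 hn.ne)
      rw [absCubicPow_of_mem hz0 (hSz hw), cpow_def_of_ne_zero hn0, ← Complex.exp_add,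
        QPlus_ofReal, ← ofReal_neg, ← ofReal_log (neg_pos.2 hpneg).le,
        ← ofReal_log (neg_pos.2 hn).le]
      congr 1
      rw [hT]
      push_cast
      ring
    rw [habs, hpow, hg]
    simp only
    rw [hexp w hw, hω w hw, hQ', Q_ofReal, real_smul, Complex.exp_neg]
    have e1 : (realCubic z w : ℂ) ≠ 0 := ofReal_ne_zero.2 hn.ne
    have e2 : ((3 * w ^ 2 - 2 * (z + 1) * w + z : ℝ) : ℂ) ≠ 0 := ofReal_ne_zero.2 hne
    have e3 := Complex.exp_ne_zero (C * Complex.log (-QPlus z))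
    rw [ofReal_neg, ofReal_mul, ofReal_div]
    generalize ((3 * w ^ 2 - 2 * (z + 1) * w + z : ℝ) : ℂ) = d at *
    field_simp
  constructor
  · rw [← himg, integrableOn_image_iff_integrableOn_abs_deriv_smul hS hderiv hinj]
    exact IntegrableOn.congr_fun (hint.const_mul _) (fun w hw => (hcomp w hw).symm) hS
  · rw [← himg, integral_image_eq_integral_abs_deriv_smul hS hderiv hinj,
      setIntegral_congr_fun hS hcomp, integral_const_mul, Complex.exp_neg]
    have e3 := Complex.exp_ne_zero (C * Complex.log (-QPlus z))
    field_simp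

/-- The critical point cuts `(z, 1)` into two monotone pieces, inverted by `w₁` on the right and by
`w₂` on the left. The opposite signs of `Q'` there turn the difference in `Phi_eq_sub` into a sum of
integrals over the two pieces. -/
theorem QPlusPow_mul_laplace_ofReal (hz : NearHalf z) (hr : RootsControlled z) (hz0 : 0 < z)
    (hz1 : z < 1) {C : ℂ} (hC : -1 < C.re) :
    QPlusPow C z * exp (-(Real.pi * I * C)) * laplace 0 (phi z) C = -I3 C z := by
  have hp1 := critPt_lt_one hz1
  have hp0 := lt_critPt hz0 hz1
  have hm := one_sub_two_mul_lt hz0 hz1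
  have hint := integrableOn_absCubicPow hz hz0 hz1 hC
  have hcont : Continuous (realCubic z) := by
    unfold realCubic
    fun_prop
  have hz' : realCubic z z = 0 := by simp [realCubic]
  have h1' : realCubic z 1 = 0 := by simp [realCubic]
  have hS1 : Ioo (critPt z) 1 ⊆ Ioo z 1 := Ioo_subset_Ioo_left hp0.le
  have hS2 : Ioo z (critPt z) ⊆ Ioo z 1 := Ioo_subset_Ioo_right hp1.le
  obtain ⟨i1, e1⟩ := integral_branch (C := C) (S := Ioo (critPt z) 1) (ε := 1) (ω := fun q => w1 q z)
    hz0 hz1 measurableSet_Ioo hS1 (fun w hw => hw.1.ne') (by norm_num)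
    (fun w hw => by
      rw [deriv_realCubic_eq, one_mul]
      exact mul_pos (mul_pos (by norm_num) (sub_pos.2 hw.1)) (by linarith [hw.1]))
    (by
      have := intermediate_value_Ioo hp1.le hcont.continuousOn
      rwa [h1'] at this)
    (fun w hw => w1_Q_ofReal hz0 hw) (hint.mono_set hS1)
  obtain ⟨i2, e2⟩ := integral_branch (C := C) (S := Ioo z (critPt z)) (ε := -1)
    (ω := fun q => w2 q z) hz0 hz1 measurableSet_Ioo hS2 (fun w hw => hw.2.ne) (by norm_num)
    (fun w hw => by
      rw [deriv_realCubic_eq]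
      have a1 : 0 < critPt z - w := sub_pos.2 hw.2
      have a2 : 0 < w - ((z + 1) / 3 - realSqrtDisc z / 3) := by linarith [hw.1]
      nlinarith [mul_pos a1 a2])
    (by
      have := intermediate_value_Ioo' hp0.le hcont.continuousOn
      rwa [hz'] at this)
    (fun w hw => w2_Q_ofReal hz0 hz1 hw) (hint.mono_set hS2)
  have hsplit : laplace 0 (phi z) C =
      (∫ t in Ioi (0 : ℝ), exp (-C * t) *
        (QPlus z * exp (-(t : ℂ)) / Q' z (w1 (QPlus z * exp (-(t : ℂ))) z))) -
      ∫ t in Ioi (0 : ℝ), exp (-C * t) *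
        (QPlus z * exp (-(t : ℂ)) / Q' z (w2 (QPlus z * exp (-(t : ℂ))) z)) := by
    rw [← integral_sub i1 i2, laplace]
    refine setIntegral_congr_fun measurableSet_Ioi fun t ht => ?_
    have ht1 : Real.exp (-t) < 1 := Real.exp_lt_one_iff.2 (neg_lt_zero.2 ht)
    have hne : 1 - cosArg (QPlus z * exp (-(t : ℂ))) z ^ 2 ≠ 0 := by
      have := hr.norm_one_sub_sq_ge (Real.exp_pos (-t)) ht1
      rw [cosArg_QPlus_mul _ _ hr.re_sqrtDisc_pos]
      rw [ofReal_exp, ofReal_neg] at this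
      exact norm_pos_iff.1 (lt_of_lt_of_le (by linarith) this)
    simp only [laplaceIntegrand_zero]
    rw [phi, Phi_eq_sub hr.re_sqrtDisc_pos hne, mul_sub]
  have hpow : QPlusPow C z * exp (-(Real.pi * I * C)) = exp (C * Complex.log (-QPlus z)) := by
    rw [QPlusPow, ← Complex.exp_add]
    congr 1
    ring
  have hI3 : I3 C z = (∫ w in Ioo z (critPt z), absCubicPow C z w) +
      ∫ w in Ioo (critPt z) 1, absCubicPow C z w := by
    rw [I3_ofReal C hz0 hz1, ← integral_Ioc_eq_integral_Ioo, ← integral_Ioc_eq_integral_Ioo,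
      ← integral_Ioc_eq_integral_Ioo, ← Ioc_union_Ioc_eq_Ioc hp0.le hp1.le]
    refine setIntegral_union (Ioc_disjoint_Ioc_of_le le_rfl) measurableSet_Ioc ?_ ?_
    · exact (integrableOn_Ioc_iff_integrableOn_Ioo).2 (hint.mono_set hS2)
    · exact (integrableOn_Ioc_iff_integrableOn_Ioo).2 (hint.mono_set hS1)
  rw [hpow, hsplit, mul_sub, e1, e2, hI3]
  push_cast
  ring

end RealPoints

/-! ### The Laplace representation of `I3` for complex `z` -/

/-- The Laplace transform of the Borel germ is the block between `z` and `1`. -/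
theorem QPlusPow_mul_laplace {r : ℝ} (hr : 0 < r)
    (hU : ∀ z ∈ ball ((1 / 2 : ℝ) : ℂ) r, NearHalf z)
    (hV : ∀ z ∈ ball ((1 / 2 : ℝ) : ℂ) r, RootsControlled z) {C z : ℂ}
    (hz : z ∈ ball ((1 / 2 : ℝ) : ℂ) r) (hC : -1 < C.re) :
    QPlusPow C z * exp (-(Real.pi * I * C)) * laplace 0 (phi z) C = -I3 C z := by
  refine eqOn_ball_of_eq_ofReal
    (f := fun z => QPlusPow C z * exp (-(Real.pi * I * C)) * laplace 0 (phi z) C)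
    (g := fun z => -I3 C z) hr ?_ (differentiableOn_I3 hU isOpen_ball hC).neg ?_ hz
  · exact ((differentiableOn_QPlusPow hV C).mul_const _).mul
      (differentiableOn_laplace hV isOpen_ball hC)
  · intro x hx
    have h := (abs_lt.1 ((abs_re_le_norm ((x : ℂ) - 1 / 2)).trans_lt (hU x hx).norm_sub_lt))
    simp at h
    exact QPlusPow_mul_laplace_ofReal (hU x hx) (hV x hx) (by linarith) (by linarith) hC

/-! ### The domain in `C` and the continuation of `I₁` -/

theorem sin_three_pi_mul_eq_zero_iff (C : ℂ) :
    Complex.sin (3 * Real.pi * C) = 0 ↔ ∃ k : ℤ, 3 * C = k := by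
  have hpi : (Real.pi : ℂ) ≠ 0 := ofReal_ne_zero.2 Real.pi_ne_zero
  rw [Complex.sin_eq_zero_iff]
  refine exists_congr fun k => ⟨fun h => mul_right_cancel₀ hpi (by linear_combination h),
    fun h => by rw [← h]; ring⟩

theorem mem_I1Domain_of_sin_ne_zero {C : ℂ} (h1 : -1 < C.re)
    (hs : Complex.sin (3 * Real.pi * C) ≠ 0) : C ∈ I1Domain := by
  refine ⟨h1, fun n hn => hs ?_⟩
  rw [sin_three_pi_mul_eq_zero_iff]
  refine ⟨(n : ℤ) - 1, ?_⟩
  push_cast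
  linear_combination hn

/-- The zeros of the sine are the `C` with `3C` an integer, and for `Re C ≥ -1/3` these are exactly
the excluded points. The bound is needed: `C = -2/3` is a zero inside the domain. -/
theorem sin_ne_zero_of_mem_I1Domain {C : ℂ} (h : C ∈ I1Domain) (h1 : -1 / 3 ≤ C.re) :
    Complex.sin (3 * Real.pi * C) ≠ 0 := by
  rw [Ne, sin_three_pi_mul_eq_zero_iff]
  rintro ⟨k, hk⟩
  have hre := congrArg re hk
  simp at hre
  have hk0 : -1 ≤ k := by
    have : ((-1 : ℤ) : ℝ) ≤ k := by
      push_cast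
      linarith
    exact_mod_cast this
  -- As `k ≥ -1`, the natural number `k + 1` involves no truncation.
  refine h.2 (k + 1).toNat ?_
  have : (((k + 1).toNat : ℤ) : ℂ) = ((k + 1 : ℤ) : ℂ) := by
    rw [Int.toNat_of_nonneg (by linarith)]
  rw [hk]
  push_cast at this
  exact this.symm

theorem mem_I1Domain_of_re_lt {C : ℂ} (h1 : -1 < C.re) (h2 : C.re < -1 / 3) : C ∈ I1Domain := by
  refine ⟨h1, fun n hn => ?_⟩
  have hre := congrArg re hn
  simp at hre
  have : (0 : ℝ) ≤ n := n.cast_nonneg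
  linarith

theorem isOpen_I1Domain : IsOpen I1Domain := by
  have e : I1Domain = {C : ℂ | -1 < C.re} ∩
      ((fun C : ℂ => 3 * C + 1) ⁻¹' (range ((↑) : ℕ → ℂ))ᶜ) := by
    ext C
    simp [I1Domain, eq_comm]
  rw [e]
  refine (isOpen_lt continuous_const continuous_re).inter
    (IsOpen.preimage (by fun_prop) (isOpen_compl_iff.2 ?_))
  have h := (Complex.isometry_ofReal.isClosedEmbedding.comp
    Nat.isClosedEmbedding_coe_real).isClosed_range
  convert! h using 2

theorem mem_I1Domain_of_im_ne_zero {C : ℂ} (h1 : -1 < C.re) (h2 : C.im ≠ 0) : C ∈ I1Domain := by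
  refine ⟨h1, fun n hn => h2 ?_⟩
  have him := congrArg im hn
  simpa using him

theorem convex_re_strip (a b : ℝ) : Convex ℝ {C : ℂ | a < C.re ∧ C.re < b} :=
  (convex_halfSpace_re_gt a).inter (convex_halfSpace_re_lt b)

theorem convex_upper : Convex ℝ {C : ℂ | -1 < C.re ∧ 0 < C.im} :=
  (convex_halfSpace_re_gt (-1)).inter (convex_halfSpace_im_gt 0)

theorem convex_lower : Convex ℝ {C : ℂ | -1 < C.re ∧ C.im < 0} :=
  (convex_halfSpace_re_gt (-1)).inter (convex_halfSpace_im_lt 0)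

theorem exists_re_strip_subset_I1Domain {C : ℂ} (hC : C ∈ I1Domain) (him : C.im = 0) :
    ∃ a b : ℝ, a < C.re ∧ C.re < b ∧ {D : ℂ | a < D.re ∧ D.re < b} ⊆ I1Domain := by
  by_cases h : C.re < -1 / 3
  · exact ⟨-1, -1 / 3, hC.1, h, fun D hD => mem_I1Domain_of_re_lt hD.1 hD.2⟩
  · rw [not_lt] at h
    -- The excluded points next to `C` are `(m - 1) / 3` and `m / 3`, and the vertical strip between
    -- them contains none.
    set m := ⌊3 * C.re + 1⌋ with hm
    have hm0 : 0 ≤ m := Int.floor_nonneg.2 (by linarith)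
    have hm1 : (m : ℝ) ≤ 3 * C.re + 1 := Int.floor_le _
    have hm2 : 3 * C.re + 1 < m + 1 := Int.lt_floor_add_one _
    have hm0' : (0 : ℝ) ≤ m := by exact_mod_cast hm0
    have hne : (m : ℝ) ≠ 3 * C.re + 1 := by
      intro he
      refine hC.2 m.toNat ?_
      have e1 : ((m.toNat : ℤ) : ℝ) = m := by rw [Int.toNat_of_nonneg hm0]
      push_cast at e1
      apply Complex.ext
      · simp
        rw [e1, he]
      · simp [him]
    refine ⟨(m - 1) / 3, m / 3, ?_, by linarith, fun D hD => ⟨?_, fun n hn => ?_⟩⟩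
    · have := lt_of_le_of_ne hm1 hne
      linarith
    · have := hD.1
      linarith
    · have hre := congrArg re hn
      simp at hre
      have h1 : (m : ℝ) < n := by
        have := hD.1
        linarith
      have h2 : (n : ℝ) < m + 1 := by
        have := hD.2
        linarith
      have h1' : m < (n : ℤ) := by exact_mod_cast h1
      have h2' : (n : ℤ) < m + 1 := by exact_mod_cast h2
      linarith

/-- The open upper quarter plane lies in the domain. It is joined to the lower one through the strip
`Re C < -1/3`, and to each real point of the domain through a vertical strip that avoids the
excluded points. -/
theorem isPreconnected_I1Domain : IsPreconnected I1Domain := by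
  have hup : {C : ℂ | -1 < C.re ∧ 0 < C.im} ⊆ I1Domain := fun C hC =>
    mem_I1Domain_of_im_ne_zero hC.1 hC.2.ne'
  have hlow : {C : ℂ | -1 < C.re ∧ C.im < 0} ⊆ I1Domain := fun C hC =>
    mem_I1Domain_of_im_ne_zero hC.1 hC.2.ne
  have hstrip : {C : ℂ | -1 < C.re ∧ C.re < -1 / 3} ⊆ I1Domain := fun C hC =>
    mem_I1Domain_of_re_lt hC.1 hC.2
  refine isPreconnected_of_forall (⟨-1 / 2, 1⟩ : ℂ) fun C hC => ?_
  have hx : (⟨-1 / 2, 1⟩ : ℂ) ∈ {C : ℂ | -1 < C.re ∧ 0 < C.im} := by norm_num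
  rcases lt_trichotomy C.im 0 with him | him | him
  · refine ⟨{C : ℂ | -1 < C.re ∧ 0 < C.im} ∪ {C : ℂ | -1 < C.re ∧ C.re < -1 / 3} ∪
      {C : ℂ | -1 < C.re ∧ C.im < 0}, union_subset (union_subset hup hstrip) hlow,
      Or.inl (Or.inl hx), Or.inr ⟨hC.1, him⟩, ?_⟩
    refine IsPreconnected.union (⟨-1 / 2, -1⟩ : ℂ) (Or.inr (by norm_num)) (by norm_num)
      (IsPreconnected.union (⟨-1 / 2, 1⟩ : ℂ) (by norm_num) (by norm_num)
        convex_upper.isPreconnected (convex_re_strip _ _).isPreconnected)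
      convex_lower.isPreconnected
  · obtain ⟨a, b, ha, hb, hab⟩ := exists_re_strip_subset_I1Domain hC him
    refine ⟨{C : ℂ | -1 < C.re ∧ 0 < C.im} ∪ {D : ℂ | a < D.re ∧ D.re < b},
      union_subset hup hab, Or.inl hx, Or.inr ⟨ha, hb⟩, ?_⟩
    exact IsPreconnected.union (⟨C.re, 1⟩ : ℂ) ⟨hC.1, one_pos⟩ ⟨ha, hb⟩
      convex_upper.isPreconnected (convex_re_strip _ _).isPreconnected
  · exact ⟨_, hup, hx, ⟨hC.1, him⟩, convex_upper.isPreconnected⟩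

/-- The continuation of `I₁` in terms of the other two blocks. -/
noncomputable def I1Quotient (C z : ℂ) : ℂ :=
  -(Complex.sin (2 * Real.pi * C) * I3 C z + Complex.sin (Real.pi * C) * I2 C z) /
    Complex.sin (3 * Real.pi * C)

open Classical in
/-- The integral in its strip of convergence, and the quotient elsewhere. -/
noncomputable def I1Glued (z C : ℂ) : ℂ :=
  if C.re < -1 / 3 then I1Integral C z else I1Quotient C z

theorem I1Glued_eq_quotient {r : ℝ} (hr : 0 < r)
    (hU : ∀ z ∈ ball ((1 / 2 : ℝ) : ℂ) r, NearHalf z) {C z : ℂ}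
    (hz : z ∈ ball ((1 / 2 : ℝ) : ℂ) r) (h1 : -1 < C.re)
    (hs : Complex.sin (3 * Real.pi * C) ≠ 0) : I1Glued z C = I1Quotient C z := by
  rw [I1Glued]
  split_ifs with h
  · rw [I1Quotient, eq_div_iff hs]
    linear_combination sin_relation hr hU hz h1 h
  · rfl

theorem isI1Continuation_I1Glued {r : ℝ} (hr : 0 < r)
    (hU : ∀ z ∈ ball ((1 / 2 : ℝ) : ℂ) r, NearHalf z) {z : ℂ}
    (hz : z ∈ ball ((1 / 2 : ℝ) : ℂ) r) : IsI1Continuation z (I1Glued z) := by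
  refine ⟨DifferentiableOn.analyticOnNhd (fun C hC => ?_) isOpen_I1Domain, fun C _ h => if_pos h⟩
  refine DifferentiableAt.differentiableWithinAt ?_
  -- In the strip the integral itself is used, because the quotient degenerates at `C = -2/3`.
  -- Elsewhere in the domain the sine is nonzero, and the quotient agrees with the glued function in
  -- a whole neighbourhood, also across the line `Re C = -1/3`.
  by_cases h : C.re < -1 / 3
  · refine (differentiableAt_I1Integral (hU z hz) hC.1 h).congr_of_eventuallyEq ?_
    filter_upwards [(isOpen_lt continuous_re continuous_const).mem_nhds h] with D hD
    exact if_pos hD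
  · have hs := sin_ne_zero_of_mem_I1Domain hC (not_lt.1 h)
    have hd : DifferentiableAt ℂ (fun C => I1Quotient C z) C := by
      unfold I1Quotient
      have h2 := differentiableAt_I2 (hU z hz) hC.1
      have h3 := differentiableAt_I3 (hU z hz) hC.1
      exact DifferentiableAt.div (by fun_prop) (by fun_prop) hs
    refine hd.congr_of_eventuallyEq ?_
    have hs' : ∀ᶠ D : ℂ in 𝓝 C, Complex.sin (3 * Real.pi * D) ≠ 0 :=
      ContinuousAt.eventually_ne (by fun_prop) hs
    filter_upwards [hs', (isOpen_lt continuous_const continuous_re).mem_nhds hC.1] with D hD hD1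
    exact I1Glued_eq_quotient hr hU hz hD1 hD

/-- Two continuations of the integral agree on `I1Domain`. -/
theorem IsI1Continuation.eqOn {z : ℂ} {F G : ℂ → ℂ} (hF : IsI1Continuation z F)
    (hG : IsI1Continuation z G) : EqOn F G I1Domain := by
  have h1 : -1 < (-1 / 2 : ℂ).re := by norm_num
  have h2 : (-1 / 2 : ℂ).re < -1 / 3 := by norm_num
  refine hF.1.eqOn_of_preconnected_of_eventuallyEq hG.1 isPreconnected_I1Domain
    (mem_I1Domain_of_re_lt h1 h2) ?_
  filter_upwards [(isOpen_lt continuous_const continuous_re).mem_nhds h1,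
    (isOpen_lt continuous_re continuous_const).mem_nhds h2] with D hD1 hD2
  rw [hF.2 D hD1 hD2, hG.2 D hD1 hD2]

theorem isI1Continuation_I1 {z : ℂ} (h : ∃ F : ℂ → ℂ, IsI1Continuation z F) :
    IsI1Continuation z (fun C => I1 C z) := by
  have e : (fun C => I1 C z) = h.choose := by
    funext C
    rw [I1, dif_pos h]
  rw [e]
  exact h.choose_spec

end CoulombGas

theorem mainTheorem2 :
    ∀ᶠ z : ℂ in nhds (1 / 2 : ℂ),
      -- `I₁` is the convergent integral in the strip, and is holomorphic in `C` on its domain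
      (∀ C : ℂ, -1 < C.re → C.re < -1 / 3 →
        MeasureTheory.IntegrableOn (fun w : ℝ => CoulombGas.Q z (w : ℂ) ^ C) (Set.Ioi 1) ∧
        CoulombGas.I1 C z = ∫ w in Set.Ioi (1 : ℝ), CoulombGas.Q z (w : ℂ) ^ C) ∧
      AnalyticOnNhd ℂ (fun C => CoulombGas.I1 C z) CoulombGas.I1Domain ∧
      -- `I₂` and the Laplace transform converge for `Re C > -1`, and the Stokes relation holds
      (∀ C : ℂ, -1 < C.re →
        IntervalIntegrable (fun t : ℝ => CoulombGas.Q z (t * z) ^ C * z)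
          MeasureTheory.volume 0 1 ∧
        MeasureTheory.IntegrableOn
          (CoulombGas.laplaceIntegrand 0 (CoulombGas.phi z) C) (Set.Ioi 0) ∧
        (Complex.sin (3 * Real.pi * C) ≠ 0 →
          CoulombGas.I1 C z =
            CoulombGas.QPlusPow C z *
                (Complex.sin (2 * Real.pi * C) / Complex.sin (3 * Real.pi * C)) *
                Complex.exp (-(Real.pi * Complex.I * C)) *
                CoulombGas.laplace 0 (CoulombGas.phi z) C -
              Complex.sin (Real.pi * C) / Complex.sin (3 * Real.pi * C) *
                CoulombGas.I2 C z)) := by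
  obtain ⟨r, hr, hball⟩ := Metric.eventually_nhds_iff_ball.1
    (CoulombGas.eventually_nearHalf.and CoulombGas.eventually_rootsControlled)
  have e : (1 / 2 : ℂ) = ((1 / 2 : ℝ) : ℂ) := by norm_num
  rw [e] at hball ⊢
  have hU := fun z hz => (hball z hz).1
  have hV := fun z hz => (hball z hz).2
  filter_upwards [Metric.ball_mem_nhds _ hr] with z hz
  have hglue := CoulombGas.isI1Continuation_I1Glued hr hU hz
  have hI1 := CoulombGas.isI1Continuation_I1 ⟨_, hglue⟩
  refine ⟨fun C h1 h2 => ⟨CoulombGas.integrableOn_I1 (hU z hz) h1 h2, hI1.2 C h1 h2⟩, hI1.1,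
    fun C h1 => ⟨CoulombGas.intervalIntegrable_I2 (hU z hz) h1,
      CoulombGas.integrableOn_laplaceIntegrand (hV z hz) h1, fun hs => ?_⟩⟩
  have h3 := CoulombGas.QPlusPow_mul_laplace hr hU hV hz h1
  have h4 : CoulombGas.I1 C z = CoulombGas.I1Quotient C z :=
    (hI1.eqOn hglue (CoulombGas.mem_I1Domain_of_sin_ne_zero h1 hs)).trans
      (CoulombGas.I1Glued_eq_quotient hr hU hz h1 hs)
  rw [h4, CoulombGas.I1Quotient]
  -- Replacing `I₃` in the quotient by its Laplace representation.
  linear_combination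
    (-Complex.sin (2 * Real.pi * C) / Complex.sin (3 * Real.pi * C)) * h3
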